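/- Let $d\in\{2,3\}$, let $\mathcal G$ be an undirected graph with $n$ vertices (agents) and $m$ edges, numbered and arbitrarily oriented, with oriented incidence matrix $B=(b_{ik})$ ($b_{ik}=-1$ if $i$ is the tail of edge $k$, $+1$ if $i$ is its head, $0$ otherwise). For positions $p=(p_1,\dots,p_n)\in(\mathbb R^d)^n$ put $z_k=\sum_i b_{ik}p_i$, let $R(z)\in\mathbb R^{m\times nd}$ be the rigidity matrix, whose $k$-th row has the blocks $b_{ik}z_k^\top$, $i=1,\dots,n$, and, for desired distances $d_1,\dots,d_m$, put $e_k=\|z_k\|-d_k$. Let $p^*$ be a target formation, $\|z_k(p^*)\|=d_k$ for all $k$, which is infinitesimally and minimally rigid: $\operatorname{rank}R(z(p^*))=m=2n-3$ if $d=2$, and $\operatorname{rank}R(z(p^*))=m=3n-6$ if $d=3$. For $\delta_u>0$ let all agents use the asymmetric uniform quantizer $q_u^*(x)=\delta_u\lfloor x/\delta_u\rfloor$ in the quantized formation controller $$\dot p_i=-\sum_{k=1}^{m} b_{ik}\,q_u^*(\|z_k\|-d_k)\,\frac{z_k}{\|z_k\|},\qquad i=1,\dots,n .$$ Write this system as $\dot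 p=X(p)$. Its solutions are understood in the sense of Filippov: locally absolutely continuous curves with $\dot p(t)\in\mathcal F[X](p(t))$ for almost every $t$, where $\mathcal F[X](x)=\bigcap_{r>0}\bigcap_{\mu(S)=0}\overline{\mathrm{co}}\,X(\mathbb B(x,r)\setminus S)$, $\mu$ being Lebesgue measure on $(\mathbb R^d)^n$. Then the inter-agent distances converge, locally around the target shape, in finite time to the set $F_{\text{aym}}=\{e\in\mathbb R^m : e_k\in[0,\delta_u],\ k=1,\dots,m\}$. Precisely: for every $\bar\delta>0$ there is $\varepsilon>0$ such that for every $\delta_u\in(0,\bar\delta]$ and every initial configuration $p(0)$ for which some isometry $g$ of $\mathbb R^d$ satisfies $\|p_i(0)-g(p_i^*)\|<\varepsilon$ for all $i$, the following hold. A Filippov solution on $[0,\infty)$ starting at $p(0)$ exists; every Filippov solution starting at $p(0)$ and defined on some $[0,\tau)$, $0<\tau<\infty$, extends to a Filippov solution on $[0,\infty)$; and for every Filippov solution on $[0,\infty)$ starting at $p(0)$ there is a finite time $T\ge 0$ such that $e(p(t))\in F_{\text{aym}}$ for all $t\ge T$. -/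

import Mathlib

open Set MeasureTheory

noncomputable section

/-! ### Filippov solutions of differential equations with discontinuous right-hand side -/

/-- The Filippov set-valued map of a vector field `X`: the intersection, over all radii `r > 0` and
all Lebesgue-null sets `S`, of the closed convex hulls of `X (B(x, r) \ S)`. -/
def filippovMap {E : Type*} [NormedAddCommGroup E] [NormedSpace ℝ E] [MeasureSpace E]
    (X : E → E) (x : E) : Set E :=
  ⋂ (r : ℝ) (_ : 0 < r) (S : Set E) (_ : volume S = 0),
    closure (convexHull ℝ (X '' (Metric.ball x r \ S)))

/-- `p` is a Filippov solution of `p' = X p` on the time interval `J`: it is absolutely continuous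
on every compact subinterval of `J`, and `p' t ∈ F[X] (p t)` for almost every `t ∈ J`. -/
def IsFilippovSolution {E : Type*} [NormedAddCommGroup E] [NormedSpace ℝ E] [MeasureSpace E]
    (X : E → E) (J : Set ℝ) (p : ℝ → E) : Prop :=
  (∀ a ∈ J, ∀ b ∈ J, AbsolutelyContinuousOnInterval p a b) ∧
    ∀ᵐ t : ℝ, t ∈ J → ∃ v ∈ filippovMap X (p t), HasDerivAt p v t

/-! ### Frameworks and rigidity -/

/-- Positions of `n` agents in `d`-dimensional Euclidean space. -/
abbrev Configuration (n d : ℕ) : Type := Fin n → EuclideanSpace ℝ (Fin d)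

/-- A numbering of the edges of the graph `G` by `Fin m` (so `m` is the number of edges), together
with an arbitrary orientation of every edge. -/
structure EdgeOrientation {n : ℕ} (G : SimpleGraph (Fin n)) (m : ℕ) where
  /-- the tail node of each edge -/
  tail : Fin m → Fin n
  /-- the head node of each edge -/
  head : Fin m → Fin n
  /-- every edge is listed at most once -/
  injective : Function.Injective fun k => s(tail k, head k)
  /-- exactly the edges of `G` are listed -/
  range_eq : (Set.range fun k => s(tail k, head k)) = G.edgeSet

namespace EdgeOrientation

variable {n m d : ℕ} {G : SimpleGraph (Fin n)}

/-- The oriented incidence matrix `B`. -/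
def incidence (o : EdgeOrientation G m) : Matrix (Fin n) (Fin m) ℝ :=
  fun i k => if i = o.tail k then -1 else if i = o.head k then 1 else 0

/-- The relative position vectors: `z k = ∑ i, b i k • p i`, which is head minus tail. -/
def relPos (o : EdgeOrientation G m) (p : Configuration n d) (k : Fin m) :
    EuclideanSpace ℝ (Fin d) :=
  ∑ i, o.incidence i k • p i

/-- The rigidity matrix: the row of edge `k` has the `d`-block `b i k • (z k)ᵀ` at agent `i`. -/
def rigidityMatrix (o : EdgeOrientation G m) (p : Configuration n d) :
    Matrix (Fin m) (Fin n × Fin d) ℝ :=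
  fun k ic => o.incidence ic.1 k * o.relPos p k ic.2

/-- The framework `(G, p)` is infinitesimally rigid: in the plane the rigidity matrix has rank
`2 n - 3`, in space it has rank `3 n - 6`. -/
def IsInfinitesimallyRigid (o : EdgeOrientation G m) (p : Configuration n d) : Prop :=
  (d = 2 ∧ (o.rigidityMatrix p).rank + 3 = 2 * n) ∨
    (d = 3 ∧ (o.rigidityMatrix p).rank + 6 = 3 * n)

/-- The framework `(G, p)` is infinitesimally and minimally rigid: it is infinitesimally rigid and
has exactly `2 n - 3` edges in the plane, `3 n - 6` edges in space. -/
def IsInfinitesimallyMinimallyRigid (o : EdgeOrientation G m) (p : Configuration n d) : Prop :=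
  o.IsInfinitesimallyRigid p ∧ ((d = 2 ∧ m + 3 = 2 * n) ∨ (d = 3 ∧ m + 6 = 3 * n))

/-! ### The quantized formation controller -/

/-- The distance errors `e k = ‖z k‖ - d k`, for desired distances `dist`. -/
def distError (o : EdgeOrientation G m) (dist : Fin m → ℝ) (p : Configuration n d) :
    Fin m → ℝ :=
  fun k => ‖o.relPos p k‖ - dist k

/-- The formation controller with quantizer `q`: the velocity of agent `i` is
`- ∑ k, b i k * q (‖z k‖ - d k) • (z k / ‖z k‖)`. -/
def controller (o : EdgeOrientation G m) (q : ℝ → ℝ) (dist : Fin m → ℝ)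
    (p : Configuration n d) : Configuration n d :=
  fun i => -∑ k, (o.incidence i k * q (o.distError dist p k)) •
    (‖o.relPos p k‖⁻¹ • o.relPos p k)

end EdgeOrientation

/-- The asymmetric uniform quantizer with gain `δ`. -/
def asymQuantizer (δ x : ℝ) : ℝ := δ * (⌊x / δ⌋ : ℝ)

/-- The set of error vectors all of whose entries lie in `[0, δ]`. -/
def asymErrorSet (m : ℕ) (δ : ℝ) : Set (Fin m → ℝ) := {e | ∀ k, e k ∈ Icc 0 δ}

/-- The shape of `p` is `ε`-close to that of `pstar`: up to a Euclidean isometry, every agent is at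
distance less than `ε` from its place in `pstar`. -/
def ShapeClose {n d : ℕ} (ε : ℝ) (pstar p : Configuration n d) : Prop :=
  ∃ g : EuclideanSpace ℝ (Fin d) ≃ᵃⁱ[ℝ] EuclideanSpace ℝ (Fin d), ∀ i, ‖p i - g (pstar i)‖ < ε

end

noncomputable section

/-! ### Absolutely continuous functions -/

/-! Let `Q` be the convex primitive of the quantizer (`asymPotential`) and `V(p) = ∑ Q(e_k)`; then
`V ≥ 0`, with equality exactly on the target set. A Filippov velocity at a nondegenerate `p` is
`velocity p ξ` with each `ξ_k` a subgradient of `Q` at `e_k`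
(`exists_of_mem_filippovMap_controller`). Since `velocity p` is minus the adjoint of the derivative
of `e`, a.e. along a solution `V' = -∑ ‖v_i‖²`.

Minimal rigidity makes `velocity p` injective, so `c ‖ξ‖ ≤ ‖v‖` near the target, with `c` the same
for all isometric copies (`exists_velocity_lower_bound`). This has two consequences, both in
`deriv_potential`. Off `[0, δ]` subgradients have size at least `δ`, so `V' ≤ -c²δ²` while `V > 0`,
which gives finite time. Also `Q ≤ 2ξ²`, so `V` is bounded by a multiple of `‖v‖²`; hence `√V`
decreases at least in proportion to the speed, and the distance from the start is at most a constant
times `√V(p(0))` (`dist_le`). That constant does not depend on `δ`, so a start close enough to the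
target never leaves the rigid ball (`mem_ball`).

Existence and continuation follow from Euler schemes for a bounded selection of the Filippov map
(`exists_lipschitz_filippov`). -/

theorem AbsolutelyContinuousOnInterval.comp_lipschitzOnWith {X Y : Type*} [PseudoMetricSpace X]
    [PseudoMetricSpace Y] {f : ℝ → X} {g : X → Y} {a b : ℝ} {K : NNReal} {s : Set X}
    (hg : LipschitzOnWith K g s) (hf : AbsolutelyContinuousOnInterval f a b)
    (hs : ∀ t ∈ uIcc a b, f t ∈ s) : AbsolutelyContinuousOnInterval (fun t => g (f t)) a b := by
  rw [absolutelyContinuousOnInterval_iff] at hf ⊢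
  intro ε hε
  obtain ⟨δ, hδ, H⟩ := hf (ε / (K + 1)) (by positivity)
  refine ⟨δ, hδ, fun E hE hlen => ?_⟩
  have h1 := H E hE hlen
  calc _ ≤ ∑ i ∈ Finset.range E.1, (K : ℝ) * dist (f (E.2 i).1) (f (E.2 i).2) := by
        refine Finset.sum_le_sum fun i hi => hg.dist_le_mul _ (hs _ (hE.1 i hi).1) _
          (hs _ (hE.1 i hi).2)
    _ = K * ∑ i ∈ Finset.range E.1, dist (f (E.2 i).1) (f (E.2 i).2) := by rw [Finset.mul_sum]
    _ ≤ (K + 1) * ∑ i ∈ Finset.range E.1, dist (f (E.2 i).1) (f (E.2 i).2) := by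
        have : 0 ≤ ∑ i ∈ Finset.range E.1, dist (f (E.2 i).1) (f (E.2 i).2) :=
          Finset.sum_nonneg fun _ _ => dist_nonneg
        nlinarith
    _ < (K + 1) * (ε / (K + 1)) := by gcongr
    _ = ε := by field_simp

theorem AbsolutelyContinuousOnInterval.le_of_ae_deriv_nonpos {f : ℝ → ℝ} {a b : ℝ} (hab : a ≤ b)
    (hf : AbsolutelyContinuousOnInterval f a b)
    (h : ∀ᵐ t : ℝ, t ∈ Ioo a b → ∃ v ≤ 0, HasDerivAt f v t) : f b ≤ f a := by
  have h1 := hf.integral_deriv_eq_sub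
  have h2 : ∫ x in a..b, deriv f x ≤ 0 := by
    rw [intervalIntegral.integral_of_le hab, ← integral_Ioc_eq_integral_Ioo.symm]
    refine setIntegral_nonpos_of_ae_restrict ?_
    rw [Filter.EventuallyLE, ae_restrict_iff' measurableSet_Ioo]
    filter_upwards [h] with t ht hmem
    obtain ⟨v, hv, hd⟩ := ht hmem
    rw [hd.deriv]; exact hv
  linarith

/-- A functional of norm at most one that attains the norm of the increment reduces this to the
scalar monotonicity statement. -/
theorem AbsolutelyContinuousOnInterval.norm_sub_le_of_ae_deriv_norm_le {E : Type*}
    [NormedAddCommGroup E] [NormedSpace ℝ E] {f : ℝ → E} {a b M : ℝ} (hab : a ≤ b)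
    (hf : AbsolutelyContinuousOnInterval f a b)
    (h : ∀ᵐ t : ℝ, t ∈ Ioo a b → ∃ v, ‖v‖ ≤ M ∧ HasDerivAt f v t) :
    ‖f b - f a‖ ≤ M * (b - a) := by
  obtain ⟨φ, hφ, hφ2⟩ := exists_dual_vector'' ℝ (f b - f a)
  have h1 : AbsolutelyContinuousOnInterval (fun t => φ (f t)) a b :=
    AbsolutelyContinuousOnInterval.comp_lipschitzOnWith (s := univ)
      (φ.lipschitz.lipschitzOnWith) hf (fun _ _ => mem_univ _)
  have h2 : AbsolutelyContinuousOnInterval (fun t : ℝ => M * t) a b := by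
    refine AbsolutelyContinuousOnInterval.const_mul M (f := fun t => t) ?_
    exact (LipschitzWith.id.lipschitzOnWith).absolutelyContinuousOnInterval
  have h3 := (h1.sub h2).le_of_ae_deriv_nonpos hab (by
    filter_upwards [h] with t ht hmem
    obtain ⟨v, hv, hd⟩ := ht hmem
    refine ⟨φ v - M, ?_, ?_⟩
    · have h4 : φ v ≤ ‖φ‖ * ‖v‖ := (le_abs_self _).trans (φ.le_opNorm v)
      have h5 : ‖φ‖ * ‖v‖ ≤ 1 * ‖v‖ := by gcongr
      linarith
    · have := (φ.hasFDerivAt.comp_hasDerivAt t hd).sub ((hasDerivAt_id t).const_mul M)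
      rw [mul_one] at this
      exact this)
  simp only [Pi.sub_apply] at h3
  have : φ (f b - f a) = ‖f b - f a‖ := by simpa using hφ2
  rw [← this, map_sub]
  linarith

/-! ### Existence of Filippov solutions of bounded vector fields -/

section Filippov

open Filter Topology Metric

variable {E : Type*} [NormedAddCommGroup E] [NormedSpace ℝ E]

/-- The Euler scheme with step `h` for the vector field `v`. -/
def eulerSeq (v : E → E) (h : ℝ) (x₀ : E) : ℕ → E
  | 0 => x₀
  | j + 1 => eulerSeq v h x₀ j + h • v (eulerSeq v h x₀ j)

theorem eulerSeq_sub (v : E → E) (h : ℝ) (x₀ : E) {a b : ℕ} (hab : a ≤ b) :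
    eulerSeq v h x₀ b - eulerSeq v h x₀ a = ∑ j ∈ Finset.Ico a b, h • v (eulerSeq v h x₀ j) := by
  induction b, hab using Nat.le_induction with
  | base => simp
  | succ b hab ih => rw [Finset.sum_Ico_succ_top hab, ← ih, eulerSeq]; abel

theorem norm_eulerSeq_sub_le {v : E → E} {M : ℝ} (hM : ∀ x, ‖v x‖ ≤ M) {h : ℝ} (hh : 0 ≤ h)
    (x₀ : E) {a b : ℕ} (hab : a ≤ b) :
    ‖eulerSeq v h x₀ b - eulerSeq v h x₀ a‖ ≤ M * (h * (b - a)) := by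
  rw [eulerSeq_sub v h x₀ hab]
  refine (norm_sum_le_of_le _ (f := fun j => h • v (eulerSeq v h x₀ j))
    (n := fun _ => h * M) fun j _ => ?_).trans_eq ?_
  · rw [norm_smul, Real.norm_of_nonneg hh]
    exact mul_le_mul_of_nonneg_left (hM _) hh
  · rw [Finset.sum_const, Nat.card_Ico, nsmul_eq_mul, Nat.cast_sub hab]; ring

/-- The slope between two nodes is the mean of the field values at the nodes in between. -/
theorem eulerSeq_slope_mem {v : E → E} {h : ℝ} (hh : 0 < h) {x₀ : E} {a b : ℕ} (hab : a < b)
    {C : Set E} (hC : Convex ℝ C) (hv : ∀ j ∈ Finset.Ico a b, v (eulerSeq v h x₀ j) ∈ C) :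
    (h * ((b : ℝ) - a))⁻¹ • (eulerSeq v h x₀ b - eulerSeq v h x₀ a) ∈ C := by
  have hpos : (0 : ℝ) < b - a := sub_pos.2 (by exact_mod_cast hab)
  rw [eulerSeq_sub v h x₀ hab.le, ← Finset.smul_sum, smul_smul, Finset.smul_sum]
  refine hC.sum_mem (fun _ _ => by positivity) ?_ hv
  rw [Finset.sum_const, Nat.card_Ico, nsmul_eq_mul, Nat.cast_sub hab.le]
  field_simp

/-- A selection `v` of a set-valued map that is bounded by `M` has a Lipschitz curve, starting at a
given point, whose derivative lies in every closed convex set containing the values of `v` near the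
current point. -/
theorem exists_lipschitz_hasDerivAt_mem [ProperSpace E] {v : E → E} {M : ℝ}
    (hM : ∀ x, ‖v x‖ ≤ M) (x₀ : E) :
    ∃ p : ℝ → E, LipschitzWith M.toNNReal p ∧ p 0 = x₀ ∧
      ∀ t, 0 < t → ∀ v₀, HasDerivAt p v₀ t → ∀ ρ > 0, ∀ C : Set E, Convex ℝ C → IsClosed C →
        (∀ x ∈ ball (p t) ρ, v x ∈ C) → v₀ ∈ C := by
  have hM0 : 0 ≤ M := (norm_nonneg _).trans (hM 0)
  let h : ℕ → ℝ := fun N => 1 / ((N : ℝ) + 1)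
  have hpos : ∀ N, 0 < h N := fun N => by positivity
  let ν : ℕ → ℝ → ℕ := fun N t => ⌊t / h N⌋₊
  -- Step functions, constant between nodes; this is the source of the extra `h N` in the
  -- Lipschitz-type bounds below. Limits along a free ultrafilter take the place of Arzelà–Ascoli.
  let q : ℕ → ℝ → E := fun N t => eulerSeq v (h N) x₀ (ν N t)
  let F : Ultrafilter ℕ := hyperfilter ℕ
  have hF : (F : Filter ℕ) ≤ atTop := by
    rw [← Nat.cofinite_eq_atTop]; exact hyperfilter_le_cofinite
  have hlim : Tendsto h F (𝓝 0) := tendsto_one_div_add_atTop_nhds_zero_nat.mono_left hF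
  have hνle : ∀ N t, 0 ≤ t → h N * ν N t ≤ t := fun N t ht => by
    have := Nat.floor_le (div_nonneg ht (hpos N).le)
    rw [le_div_iff₀ (hpos N)] at this
    linarith
  have hνlt : ∀ N t, t < h N * ν N t + h N := fun N t => by
    have := Nat.lt_floor_add_one (t / h N)
    rw [div_lt_iff₀ (hpos N)] at this
    linarith
  have hνmono : ∀ N s t, s ≤ t → ν N s ≤ ν N t := fun N s t hst =>
    Nat.floor_mono (div_le_div_of_nonneg_right hst (hpos N).le)
  have hν0 : ∀ N t, t ≤ 0 → ν N t = 0 := fun N t ht =>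
    Nat.floor_of_nonpos (div_nonpos_of_nonpos_of_nonneg ht (hpos N).le)
  have hgap : ∀ N s t, s ≤ t → h N * ((ν N t : ℝ) - ν N s) ≤ (t - s) + h N := by
    intro N s t hst
    have hN := hpos N
    rcases le_total t 0 with ht | ht
    · rw [hν0 N t ht, hν0 N s (hst.trans ht)]; simp; linarith
    · have := hνle N t ht
      have := hνlt N s
      linarith
  have hq : ∀ N s t, s ≤ t → ‖q N t - q N s‖ ≤ M * (t - s + h N) := fun N s t hst =>
    (norm_eulerSeq_sub_le hM (hpos N).le x₀ (hνmono N s t hst)).trans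
      (mul_le_mul_of_nonneg_left (hgap N s t hst) hM0)
  have hq0 : ∀ N, q N 0 = x₀ := fun N => by simp only [q, hν0 N 0 le_rfl]; rfl
  have hex : ∀ t, ∃ y, Tendsto (fun N => q N t) F (𝓝 y) := by
    intro t
    have hmem : ∀ N, q N t ∈ closedBall x₀ (M * (|t| + 1)) := by
      intro N
      have hN1 : h N ≤ 1 := by
        simp only [h]
        rw [div_le_one (by positivity)]
        linarith [(Nat.cast_nonneg N : (0 : ℝ) ≤ N)]
      rw [mem_closedBall, dist_eq_norm]
      rcases le_total 0 t with ht | ht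
      · have := hq N 0 t ht
        rw [hq0] at this
        refine this.trans (mul_le_mul_of_nonneg_left ?_ hM0)
        linarith [le_abs_self t]
      · have := hq N t 0 ht
        rw [hq0, norm_sub_rev] at this
        refine this.trans (mul_le_mul_of_nonneg_left ?_ hM0)
        linarith [neg_abs_le t]
    obtain ⟨y, -, hy⟩ := (isCompact_closedBall x₀ (M * (|t| + 1))).ultrafilter_le_nhds'
      (F.map fun N => q N t) (by
        rw [Ultrafilter.mem_map]
        exact univ_mem' hmem)
    exact ⟨y, hy⟩
  choose p hp using hex
  have hpL : ∀ s t, s ≤ t → ‖p t - p s‖ ≤ M * (t - s) := by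
    intro s t hst
    have h1 : Tendsto (fun N => M * (t - s + h N)) F (𝓝 (M * (t - s))) := by
      simpa using (hlim.const_add (t - s)).const_mul M
    exact le_of_tendsto_of_tendsto' ((hp t).sub (hp s)).norm h1 fun N => hq N s t hst
  refine ⟨p, ?_, ?_, ?_⟩
  · refine LipschitzWith.of_dist_le_mul fun s t => ?_
    rw [Real.coe_toNNReal M hM0]
    rcases le_total s t with hst | hst
    · rw [dist_comm, dist_eq_norm, dist_comm s t, Real.dist_eq, abs_of_nonneg (sub_nonneg.2 hst)]
      exact hpL s t hst
    · rw [dist_eq_norm, Real.dist_eq, abs_of_nonneg (sub_nonneg.2 hst)]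
      exact hpL t s hst
  · refine tendsto_nhds_unique (hp 0) ?_
    simp only [hq0]
    exact tendsto_const_nhds
  · intro t ht v₀ hv₀ ρ hρ C hC hC' hvC
    refine hC'.mem_of_tendsto hv₀.tendsto_slope_zero_right ?_
    -- The derivative is a limit of right difference quotients, each a limit of Euler slopes. The
    -- nodes used stay in the `ρ`-ball: `M s`, `M * h N` and the distance from `q N t` to `p t` are
    -- each at most `ρ / 4`.
    have hσ : 0 < ρ / (4 * (M + 1)) := by positivity
    filter_upwards [Ioo_mem_nhdsGT hσ] with s hs
    have hs0 : 0 < s := hs.1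
    have hMs : M * s ≤ ρ / 4 := by
      have := hs.2.le
      rw [le_div_iff₀ (by positivity)] at this
      nlinarith
    have hgl : Tendsto (fun N => h N * ((ν N (t + s) : ℝ) - ν N t)) F (𝓝 s) := by
      have l1 : Tendsto (fun N => s - h N) F (𝓝 s) := by simpa using hlim.const_sub s
      have l2 : Tendsto (fun N => s + h N) F (𝓝 s) := by simpa using hlim.const_add s
      refine tendsto_of_tendsto_of_tendsto_of_le_of_le l1 l2 (fun N => ?_) (fun N => ?_)
      · have := hνlt N (t + s)
        have := hνle N t ht.le
        show s - h N ≤ _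
        linarith
      · have := hgap N t (t + s) (by linarith)
        show _ ≤ s + h N
        linarith
    have hslope : Tendsto (fun N => (h N * ((ν N (t + s) : ℝ) - ν N t))⁻¹ •
        (q N (t + s) - q N t)) F (𝓝 (s⁻¹ • (p (t + s) - p t))) :=
      (hgl.inv₀ hs0.ne').smul ((hp (t + s)).sub (hp t))
    refine hC'.mem_of_tendsto hslope ?_
    have e1 : ∀ᶠ N in (F : Filter ℕ), dist (q N t) (p t) < ρ / 4 :=
      (hp t).eventually (ball_mem_nhds _ (by positivity))
    have e2 : ∀ᶠ N in (F : Filter ℕ), M * h N < ρ / 4 := by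
      have : Tendsto (fun N => M * h N) F (𝓝 0) := by simpa using hlim.const_mul M
      exact this.eventually (gt_mem_nhds (by positivity))
    have e3 := hgl.eventually (lt_mem_nhds hs0)
    filter_upwards [e1, e2, e3] with N h1 h2 h3
    have hlt : ν N t < ν N (t + s) := by
      have : (0 : ℝ) < (ν N (t + s) : ℝ) - ν N t := (mul_pos_iff_of_pos_left (hpos N)).1 h3
      exact_mod_cast sub_pos.1 this
    refine eulerSeq_slope_mem (hpos N) hlt hC fun j hj => hvC _ ?_
    rw [Finset.mem_Ico] at hj
    have h4 := norm_eulerSeq_sub_le hM (hpos N).le x₀ hj.1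
    have h5 : h N * ((j : ℝ) - ν N t) ≤ s + h N := by
      have := hgap N t (t + s) (by linarith)
      have hj2 : (j : ℝ) ≤ ν N (t + s) := by exact_mod_cast hj.2.le
      have := mul_le_mul_of_nonneg_left hj2 (hpos N).le
      linarith
    have h6 := mul_le_mul_of_nonneg_left h5 hM0
    rw [mem_ball]
    calc _ ≤ dist (eulerSeq v (h N) x₀ j) (q N t) + dist (q N t) (p t) := dist_triangle _ _ _
      _ < ρ := by rw [dist_eq_norm]; simp only [q] at h1 ⊢; linarith

variable [MeasureSpace E]

theorem filippovMap_subset_of_ball_subset {X : E → E} {x y : E} {r ρ : ℝ} (hr : 0 < r)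
    (h : ball y r ⊆ ball x ρ) {S : Set E} (hS : volume S = 0) :
    filippovMap X y ⊆ closure (convexHull ℝ (X '' (ball x ρ \ S))) := by
  intro v hv
  simp only [filippovMap, mem_iInter] at hv
  exact closure_mono (convexHull_mono (image_mono (sdiff_subset_sdiff_left h))) (hv r hr S hS)

theorem filippovMap_subset_of_forall_ball {X : E → E} {x : E} {r : ℝ} (hr : 0 < r) {K : Set E}
    (hK : Convex ℝ K) (hK' : IsClosed K) (h : ∀ y ∈ ball x r, X y ∈ K) : filippovMap X x ⊆ K := by
  refine (filippovMap_subset_of_ball_subset hr Subset.rfl measure_empty).trans ?_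
  refine closure_minimal (convexHull_min ?_ hK) hK'
  rintro _ ⟨y, hy, rfl⟩
  exact h y hy.1

theorem norm_le_of_mem_filippovMap {X : E → E} {U : Set E} (hU : IsOpen U) {M : ℝ}
    (hM : ∀ x ∈ U, ‖X x‖ ≤ M) {x v : E} (hx : x ∈ U) (hv : v ∈ filippovMap X x) : ‖v‖ ≤ M := by
  obtain ⟨r, hr, hrU⟩ := Metric.isOpen_iff.1 hU x hx
  simpa using filippovMap_subset_of_forall_ball hr (convex_closedBall (0 : E) M)
    isClosed_closedBall (fun y hy => by simpa using hM y (hrU hy)) hv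

/-- Compactness: for radii at most `r₀` the hulls form a directed family of compact sets, nonempty
because a ball is never a null set. -/
theorem filippovMap_nonempty [ProperSpace E] [(volume : Measure E).IsOpenPosMeasure]
    {X : E → E} {U : Set E} (hU : IsOpen U) {M : ℝ} (hM : ∀ x ∈ U, ‖X x‖ ≤ M) {x : E}
    (hx : x ∈ U) : (filippovMap X x).Nonempty := by
  obtain ⟨r₀, hr₀, hrU⟩ := Metric.isOpen_iff.1 hU x hx
  let ι := {q : ℝ × Set E // 0 < q.1 ∧ q.1 ≤ r₀ ∧ volume q.2 = 0}
  let C : ι → Set E := fun q => closure (convexHull ℝ (X '' (ball x q.1.1 \ q.1.2)))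
  have hsub : ∀ q, C q ⊆ closedBall 0 M := by
    intro q
    refine closure_minimal (convexHull_min ?_ (convex_closedBall _ _)) isClosed_closedBall
    rintro _ ⟨y, hy, rfl⟩
    simpa using hM y (hrU (ball_subset_ball q.2.2.1 hy.1))
  have : Nonempty ι := ⟨⟨(r₀, ∅), hr₀, le_rfl, measure_empty⟩⟩
  have key : (⋂ q, C q).Nonempty := by
    refine IsCompact.nonempty_iInter_of_directed_nonempty_isCompact_isClosed C ?_ ?_ ?_ ?_
    · intro q q'
      refine ⟨⟨(min q.1.1 q'.1.1, q.1.2 ∪ q'.1.2), lt_min q.2.1 q'.2.1,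
        (min_le_left _ _).trans q.2.2.1, measure_union_null q.2.2.2 q'.2.2.2⟩, ?_, ?_⟩
      · exact closure_mono (convexHull_mono (image_mono
          (sdiff_subset_sdiff (ball_subset_ball (min_le_left _ _)) subset_union_left)))
      · exact closure_mono (convexHull_mono (image_mono
          (sdiff_subset_sdiff (ball_subset_ball (min_le_right _ _)) subset_union_right)))
    · intro q
      have : (ball x q.1.1 \ q.1.2).Nonempty := by
        by_contra h
        rw [not_nonempty_iff_eq_empty, sdiff_eq_empty] at h
        exact (measure_ball_pos volume x q.2.1).ne' (measure_mono_null h q.2.2.2)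
      exact ((this.image X).mono (subset_convexHull ℝ _)).closure
    · exact fun q => (isCompact_closedBall (0 : E) M).of_isClosed_subset isClosed_closure (hsub q)
    · exact fun q => isClosed_closure
  obtain ⟨v, hv⟩ := key
  refine ⟨v, ?_⟩
  simp only [filippovMap, mem_iInter]
  intro r hr S hS
  have := mem_iInter.1 hv ⟨(min r r₀, S), lt_min hr hr₀, min_le_right _ _, hS⟩
  exact closure_mono (convexHull_mono (image_mono
    (sdiff_subset_sdiff_left (ball_subset_ball (min_le_left _ _))))) this

/-- The Euler scheme runs on a selection of the Filippov map rather than on `X` itself, so its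
values already ignore null sets. Outside `U` the selection is zero. -/
theorem exists_lipschitz_filippov [FiniteDimensional ℝ E]
    [(volume : Measure E).IsOpenPosMeasure] {X : E → E} {U : Set E} (hU : IsOpen U) {M : ℝ}
    (hM0 : 0 ≤ M) (hM : ∀ x ∈ U, ‖X x‖ ≤ M) (x₀ : E) :
    ∃ p : ℝ → E, LipschitzWith M.toNNReal p ∧ p 0 = x₀ ∧
      ∀ᵐ t : ℝ, 0 < t → p t ∈ U → ∃ v ∈ filippovMap X (p t), HasDerivAt p v t := by
  have : ProperSpace E := FiniteDimensional.proper ℝ E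
  have hsel : ∀ x, ∃ v, ‖v‖ ≤ M ∧ (x ∈ U → v ∈ filippovMap X x) := by
    intro x
    by_cases hx : x ∈ U
    · obtain ⟨v, hv⟩ := filippovMap_nonempty hU hM hx
      exact ⟨v, norm_le_of_mem_filippovMap hU hM hx hv, fun _ => hv⟩
    · exact ⟨0, by simpa using hM0, fun h => (hx h).elim⟩
  choose v hv1 hv2 using hsel
  obtain ⟨p, hpL, hp0, hp⟩ := exists_lipschitz_hasDerivAt_mem hv1 x₀
  refine ⟨p, hpL, hp0, ?_⟩
  filter_upwards [hpL.ae_differentiableAt_real] with t hd ht htU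
  refine ⟨deriv p t, ?_, hd.hasDerivAt⟩
  simp only [filippovMap, mem_iInter]
  intro r hr S hS
  obtain ⟨r₀, hr₀, hrU⟩ := Metric.isOpen_iff.1 hU (p t) htU
  -- `r₀` keeps nearby points in `U`; `r / 2` makes the `r / 2`-balls around them lie in the
  -- `r`-ball around `p t`.
  refine hp t ht _ hd.hasDerivAt (min r₀ (r / 2)) (lt_min hr₀ (by positivity)) _
    (convex_convexHull ℝ _).closure isClosed_closure fun x hx => ?_
  have hx1 : x ∈ U := hrU (ball_subset_ball (min_le_left _ _) hx)
  refine filippovMap_subset_of_ball_subset (half_pos hr) (fun y hy => ?_) hS (hv2 x hx1)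
  have := ball_subset_ball (min_le_right _ _) hx
  rw [mem_ball] at *
  linarith [dist_triangle y x (p t)]

end Filippov

/-! ### The potential of the asymmetric quantizer -/

/-- The convex, piecewise affine primitive of the asymmetric quantizer. -/
def asymPotential (δ x : ℝ) : ℝ :=
  δ * ⌊x / δ⌋ * x - δ ^ 2 * (⌊x / δ⌋ * (⌊x / δ⌋ + 1)) / 2

/-- The set of all limits of the asymmetric quantizer at `x` and their convex combinations. -/
def asymSubgradient (δ x : ℝ) : Set ℝ := Icc (δ * ((⌈x / δ⌉ : ℝ) - 1)) (asymQuantizer δ x)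

/-- The potential is the upper envelope of these lines. With `y = δ w` and `n = ⌊w⌋` the gap is `δ²
(n - j)(w - (n + j + 1)/2)`, whose factors have the same sign. -/
theorem line_le_asymPotential {δ : ℝ} (hδ : 0 < δ) (y : ℝ) (j : ℤ) :
    δ * j * y - δ ^ 2 * (j * (j + 1)) / 2 ≤ asymPotential δ y := by
  unfold asymPotential
  obtain ⟨w, rfl⟩ : ∃ w, y = δ * w := ⟨y / δ, by field_simp⟩
  have : δ * w / δ = w := by field_simp
  rw [this]
  have h1 := Int.floor_le w
  have h2 := Int.lt_floor_add_one w
  set n := ⌊w⌋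
  have key : 0 ≤ ((n : ℝ) - j) * (w - (n + j + 1) / 2) := by
    rcases lt_trichotomy n j with h | h | h
    · have : (n : ℝ) + 1 ≤ j := by exact_mod_cast h
      apply mul_nonneg_of_nonpos_of_nonpos <;> linarith
    · simp [h]
    · have : (j : ℝ) + 1 ≤ n := by exact_mod_cast h
      apply mul_nonneg <;> linarith
  nlinarith [mul_nonneg (sq_nonneg δ) key]

/-- At a multiple of `δ` two lines of the envelope meet; this is the left one, whose slope is the
lower end of `asymSubgradient`. -/
theorem asymPotential_eq_ceil {δ : ℝ} (hδ : 0 < δ) (x : ℝ) :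
    asymPotential δ x = δ * ((⌈x / δ⌉ : ℝ) - 1) * x
      - δ ^ 2 * (((⌈x / δ⌉ : ℝ) - 1) * ⌈x / δ⌉) / 2 := by
  unfold asymPotential
  obtain ⟨w, rfl⟩ : ∃ w, x = δ * w := ⟨x / δ, by field_simp⟩
  have : δ * w / δ = w := by field_simp
  rw [this]
  by_cases h : (⌊w⌋ : ℝ) = w
  · have : ⌈w⌉ = ⌊w⌋ := by
      conv_lhs => rw [← h]
      simp
    rw [this, h]; ring
  · have h1 : ⌈w⌉ = ⌊w⌋ + 1 := by
      rw [Int.ceil_eq_iff]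
      have := lt_of_le_of_ne (Int.floor_le w) h
      have := Int.lt_floor_add_one w
      push_cast
      constructor <;> linarith
    rw [h1]; push_cast; ring

/-- Both ends of the subgradient interval are slopes of supporting lines at `x`: the upper end
serves `y ≥ x`, the lower end `y ≤ x`. -/
theorem asymPotential_subgradient {δ : ℝ} (hδ : 0 < δ) {x ξ : ℝ} (hξ : ξ ∈ asymSubgradient δ x)
    (y : ℝ) : asymPotential δ x + ξ * (y - x) ≤ asymPotential δ y := by
  have h1 := line_le_asymPotential hδ y ⌊x / δ⌋
  have h2 := line_le_asymPotential hδ y (⌈x / δ⌉ - 1)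
  have h3 := asymPotential_eq_ceil hδ x
  have h4 : asymPotential δ x = δ * ⌊x / δ⌋ * x - δ ^ 2 * (⌊x / δ⌋ * (⌊x / δ⌋ + 1)) / 2 := rfl
  push_cast at h2
  have h5 := hξ.1
  have h6 : ξ ≤ δ * ⌊x / δ⌋ := hξ.2
  rcases le_total x y with h | h
  · have := mul_le_mul_of_nonneg_right h6 (sub_nonneg.2 h)
    nlinarith
  · have := mul_le_mul_of_nonpos_right h5 (sub_nonpos.2 h)
    nlinarith

theorem asymPotential_nonneg {δ : ℝ} (hδ : 0 < δ) (x : ℝ) : 0 ≤ asymPotential δ x := by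
  simpa using line_le_asymPotential hδ x 0

theorem asymPotential_zero (δ : ℝ) : asymPotential δ 0 = 0 := by simp [asymPotential]

theorem asymQuantizer_mem_asymSubgradient {δ : ℝ} (hδ : 0 < δ) (x : ℝ) :
    asymQuantizer δ x ∈ asymSubgradient δ x := by
  refine ⟨mul_le_mul_of_nonneg_left ?_ hδ.le, le_rfl⟩
  have : ⌈x / δ⌉ ≤ ⌊x / δ⌋ + 1 := Int.ceil_le_floor_add_one _
  have : (⌈x / δ⌉ : ℝ) ≤ ⌊x / δ⌋ + 1 := by exact_mod_cast this
  linarith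

theorem abs_asymQuantizer_le {δ : ℝ} (hδ : 0 < δ) (x : ℝ) : |asymQuantizer δ x| ≤ |x| + δ := by
  have h1 := mul_le_mul_of_nonneg_left (Int.floor_le (x / δ)) hδ.le
  have h2 := mul_le_mul_of_nonneg_left (Int.lt_floor_add_one (x / δ)).le hδ.le
  have h3 : δ * (x / δ) = x := by field_simp
  have h4 := neg_abs_le x
  have h5 := le_abs_self x
  unfold asymQuantizer
  rw [abs_le]
  constructor <;> linarith

theorem asymPotential_le {δ : ℝ} (hδ : 0 < δ) {x ξ : ℝ} (hξ : ξ ∈ asymSubgradient δ x) :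
    asymPotential δ x ≤ ξ * x := by
  have := asymPotential_subgradient hδ hξ 0
  rw [asymPotential_zero] at this
  linarith

theorem asymPotential_le_abs {δ : ℝ} (hδ : 0 < δ) (x : ℝ) :
    asymPotential δ x ≤ (|x| + δ) * |x| :=
  (asymPotential_le hδ (asymQuantizer_mem_asymSubgradient hδ x)).trans <|
    (le_abs_self _).trans <| by
      rw [abs_mul]
      exact mul_le_mul_of_nonneg_right (abs_asymQuantizer_le hδ x) (abs_nonneg x)

theorem abs_asymPotential_sub_le {δ : ℝ} (hδ : 0 < δ) {x y a : ℝ} (hx : |x| ≤ a) (hy : |y| ≤ a) :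
    |asymPotential δ x - asymPotential δ y| ≤ (a + δ) * |x - y| := by
  have aux : ∀ u v : ℝ, |u| ≤ a →
      asymPotential δ u - asymPotential δ v ≤ (a + δ) * |u - v| := by
    intro u v hu
    have h1 := asymPotential_subgradient hδ (asymQuantizer_mem_asymSubgradient hδ u) v
    have h2 : asymQuantizer δ u * (u - v) ≤ (a + δ) * |u - v| := by
      refine (le_abs_self _).trans ?_
      rw [abs_mul]
      refine mul_le_mul_of_nonneg_right ?_ (abs_nonneg _)
      exact (abs_asymQuantizer_le hδ u).trans (by linarith)
    linarith
  rw [abs_le]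
  have h1 := aux x y hx
  have h2 := aux y x hy
  rw [abs_sub_comm] at h2
  constructor <;> linarith

/-- Off the interval `[0, δ]` the subgradients are bounded away from zero. -/
theorem le_abs_of_mem_asymSubgradient {δ : ℝ} (hδ : 0 < δ) {x ξ : ℝ}
    (hξ : ξ ∈ asymSubgradient δ x) (hx : x ∉ Icc 0 δ) : δ ≤ |ξ| ∧ |x| ≤ 2 * |ξ| := by
  have h1 := hξ.1
  have h2 : ξ ≤ δ * ⌊x / δ⌋ := hξ.2
  have h3 : δ * (x / δ) = x := by field_simp
  rw [mem_Icc, not_and_or, not_le, not_le] at hx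
  rcases hx with hx | hx
  · have h4 : ⌊x / δ⌋ ≤ -1 := by
      have : ⌊x / δ⌋ < 0 := Int.floor_lt.2 (by simpa using div_neg_of_neg_of_pos hx hδ)
      omega
    have h4' : (⌊x / δ⌋ : ℝ) ≤ -1 := by exact_mod_cast h4
    have h5 := mul_le_mul_of_nonneg_left h4' hδ.le
    have h6 := mul_le_mul_of_nonneg_left (Int.floor_le (x / δ)) hδ.le
    rw [abs_of_neg hx, abs_of_neg (by linarith)]
    constructor <;> linarith
  -- The factor 2 is needed on this side: `ξ = δ` is a subgradient at `x = 2δ`.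
  · have h4 : 1 < ⌈x / δ⌉ := Int.lt_ceil.2 (by push_cast; rwa [one_lt_div hδ])
    have h4' : (2 : ℝ) ≤ ⌈x / δ⌉ := by exact_mod_cast h4
    have h5 := mul_le_mul_of_nonneg_left h4' hδ.le
    have h6 := mul_le_mul_of_nonneg_left (Int.le_ceil (x / δ)) hδ.le
    rw [abs_of_pos (by linarith), abs_of_pos (by linarith)]
    constructor <;> linarith

theorem asymPotential_eq_zero_iff {δ : ℝ} (hδ : 0 < δ) (x : ℝ) :
    asymPotential δ x = 0 ↔ x ∈ Icc 0 δ := by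
  constructor
  · intro h
    have h1 := line_le_asymPotential hδ x 1
    have h2 := line_le_asymPotential hδ x (-1)
    rw [h] at h1 h2
    push_cast at h1 h2
    constructor
    · nlinarith
    · by_contra! h3
      nlinarith
  · rintro ⟨h1, h2⟩
    rcases h2.lt_or_eq with h2 | rfl
    · have : ⌊x / δ⌋ = 0 := by
        rw [Int.floor_eq_iff]
        constructor
        · simpa using div_nonneg h1 hδ.le
        · simpa using (div_lt_one hδ).2 h2
      simp [asymPotential, this]
    · simp [asymPotential, hδ.ne']; ring

/-- Outside `[0, δ]` it combines `Q ≤ ξ x` with `|x| ≤ 2 |ξ|`. The constant does not involve `δ`,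
which makes the travel bound uniform in `δ`. -/
theorem asymPotential_le_sq {δ : ℝ} (hδ : 0 < δ) {x ξ : ℝ} (hξ : ξ ∈ asymSubgradient δ x) :
    asymPotential δ x ≤ 2 * ξ ^ 2 := by
  by_cases hx : x ∈ Icc 0 δ
  · rw [(asymPotential_eq_zero_iff hδ x).2 hx]; positivity
  · have h1 := (le_abs_of_mem_asymSubgradient hδ hξ hx).2
    have h2 := (asymPotential_le hδ hξ).trans (le_abs_self _)
    rw [abs_mul] at h2
    nlinarith [abs_nonneg ξ, sq_abs ξ]

/-- Upper semicontinuity: near `x / δ` the floor only takes values between `⌈x / δ⌉ - 1` and `⌊x /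
δ⌋`. -/
theorem eventually_asymQuantizer_mem {δ : ℝ} (hδ : 0 < δ) (x : ℝ) :
    ∀ᶠ y in nhds x, asymQuantizer δ y ∈ asymSubgradient δ x := by
  have hc : Filter.Tendsto (fun y : ℝ => y / δ) (nhds x) (nhds (x / δ)) :=
    (continuous_id.div_const δ).tendsto x
  have h1 : (⌈x / δ⌉ : ℝ) - 1 < x / δ := by linarith [Int.ceil_lt_add_one (x / δ)]
  filter_upwards [hc.eventually (lt_mem_nhds h1),
    hc.eventually (gt_mem_nhds (Int.lt_floor_add_one (x / δ)))] with y hy1 hy2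
  constructor
  · refine mul_le_mul_of_nonneg_left ?_ hδ.le
    have : ⌈x / δ⌉ - 1 ≤ ⌊y / δ⌋ := Int.le_floor.2 (by push_cast; exact hy1.le)
    exact_mod_cast this
  · refine mul_le_mul_of_nonneg_left ?_ hδ.le
    have : ⌊y / δ⌋ < ⌊x / δ⌋ + 1 := Int.floor_lt.2 (by push_cast; exact hy2)
    have : ⌊y / δ⌋ ≤ ⌊x / δ⌋ := by omega
    exact_mod_cast this

/-! ### The velocity field of a formation -/

namespace EdgeOrientation

open Filter Topology

variable {n m d : ℕ} {G : SimpleGraph (Fin n)}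

theorem tail_ne_head (o : EdgeOrientation G m) (k : Fin m) : o.tail k ≠ o.head k := by
  have : s(o.tail k, o.head k) ∈ G.edgeSet := by
    rw [← o.range_eq]; exact mem_range_self k
  exact G.ne_of_adj this

theorem relPos_eq (o : EdgeOrientation G m) (p : Configuration n d) (k : Fin m) :
    o.relPos p k = p (o.head k) - p (o.tail k) := by
  have h : ∀ i, o.incidence i k • p i =
      (if i = o.head k then p i else 0) - (if i = o.tail k then p i else 0) := by
    intro i
    have := o.tail_ne_head k
    unfold incidence
    by_cases h1 : i = o.tail k
    · have h2 : i ≠ o.head k := h1 ▸ this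
      simp [h1, this]
    · by_cases h2 : i = o.head k <;> simp [h1, h2, this.symm]
  simp only [relPos, h, Finset.sum_sub_distrib, Finset.sum_ite_eq', Finset.mem_univ, if_true]

theorem abs_incidence_le_one (o : EdgeOrientation G m) (i : Fin n) (k : Fin m) :
    |o.incidence i k| ≤ 1 := by
  unfold incidence
  split_ifs <;> simp

theorem norm_relPos_sub_le (o : EdgeOrientation G m) (p q : Configuration n d) (k : Fin m) :
    ‖o.relPos p k - o.relPos q k‖ ≤ 2 * dist p q := by
  rw [relPos_eq, relPos_eq, sub_sub_sub_comm]
  refine (norm_sub_le _ _).trans ?_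
  rw [← dist_eq_norm, ← dist_eq_norm]
  linarith [dist_le_pi_dist p q (o.head k), dist_le_pi_dist p q (o.tail k)]

theorem continuous_relPos (o : EdgeOrientation G m) (k : Fin m) :
    Continuous fun p : Configuration n d => o.relPos p k := by
  simp only [relPos_eq]; fun_prop

theorem relPos_isometry (o : EdgeOrientation G m)
    (g : EuclideanSpace ℝ (Fin d) ≃ᵃⁱ[ℝ] EuclideanSpace ℝ (Fin d)) (p : Configuration n d)
    (k : Fin m) : o.relPos (fun i => g (p i)) k = g.linearIsometryEquiv (o.relPos p k) := by
  rw [relPos_eq, relPos_eq]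
  have := g.toAffineEquiv.toAffineMap.linearMap_vsub (p (o.head k)) (p (o.tail k))
  simpa using this.symm

/-- The unit vector along an edge. -/
def unitVec (o : EdgeOrientation G m) (p : Configuration n d) (k : Fin m) :
    EuclideanSpace ℝ (Fin d) := ‖o.relPos p k‖⁻¹ • o.relPos p k

theorem norm_unitVec_le (o : EdgeOrientation G m) (p : Configuration n d) (k : Fin m) :
    ‖o.unitVec p k‖ ≤ 1 := by
  rw [unitVec, norm_smul, norm_inv, norm_norm]
  exact inv_mul_le_one

theorem continuousAt_unitVec (o : EdgeOrientation G m) {p : Configuration n d} {k : Fin m}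
    (h : o.relPos p k ≠ 0) : ContinuousAt (fun q => o.unitVec q k) p :=
  ((o.continuous_relPos k).norm.continuousAt.inv₀ (norm_ne_zero_iff.2 h)).smul
    (o.continuous_relPos k).continuousAt

/-- The velocity of the formation when edge `k` is driven by the scalar signal `ξ k`. -/
def velocity (o : EdgeOrientation G m) (p : Configuration n d) :
    (Fin m → ℝ) →ₗ[ℝ] Configuration n d where
  toFun ξ := fun i => -∑ k, (o.incidence i k * ξ k) • o.unitVec p k
  map_add' ξ ζ := by
    funext i
    simp [mul_add, add_smul, Finset.sum_add_distrib]
    abel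
  map_smul' c ξ := by
    funext i
    simp [Finset.smul_sum, smul_smul, mul_left_comm]

theorem velocity_apply (o : EdgeOrientation G m) (p : Configuration n d) (ξ : Fin m → ℝ)
    (i : Fin n) : o.velocity p ξ i = -∑ k, (o.incidence i k * ξ k) • o.unitVec p k := rfl

theorem controller_eq_velocity (o : EdgeOrientation G m) (q : ℝ → ℝ) (dist : Fin m → ℝ)
    (p : Configuration n d) :
    o.controller q dist p = o.velocity p fun k => q (o.distError dist p k) := rfl

theorem norm_velocity_sub_le (o : EdgeOrientation G m) (p q : Configuration n d)
    (ξ : Fin m → ℝ) : ‖o.velocity p ξ - o.velocity q ξ‖ ≤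
      ‖ξ‖ * ∑ k, ‖o.unitVec p k - o.unitVec q k‖ := by
  refine (pi_norm_le_iff_of_nonneg (by positivity)).2 fun i => ?_
  rw [Pi.sub_apply, velocity_apply, velocity_apply, neg_sub_neg, ← Finset.sum_sub_distrib,
    Finset.mul_sum]
  refine norm_sum_le_of_le _ fun k _ => ?_
  rw [← smul_sub, norm_smul, norm_sub_rev, norm_mul]
  gcongr
  calc _ ≤ 1 * ‖ξ‖ := by
        gcongr
        · exact o.abs_incidence_le_one i k
        · exact norm_le_pi_norm ξ k
    _ = _ := one_mul _

theorem norm_velocity_le (o : EdgeOrientation G m) (p : Configuration n d) (ξ : Fin m → ℝ) :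
    ‖o.velocity p ξ‖ ≤ ∑ k, |ξ k| := by
  refine (pi_norm_le_iff_of_nonneg (by positivity)).2 fun i => ?_
  rw [velocity_apply, norm_neg]
  refine norm_sum_le_of_le _ fun k _ => ?_
  rw [norm_smul, norm_mul, Real.norm_eq_abs, Real.norm_eq_abs]
  calc _ ≤ 1 * |ξ k| * 1 := by
        gcongr
        · exact o.abs_incidence_le_one i k
        · exact o.norm_unitVec_le p k
    _ = _ := by ring

theorem tendsto_sum_norm_unitVec_sub (o : EdgeOrientation G m) {p : Configuration n d}
    (h : ∀ k, o.relPos p k ≠ 0) :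
    Tendsto (fun q => ∑ k, ‖o.unitVec q k - o.unitVec p k‖) (𝓝 p) (𝓝 0) := by
  have : Tendsto (fun q => ∑ k, ‖o.unitVec q k - o.unitVec p k‖) (𝓝 p)
      (𝓝 (∑ k, ‖o.unitVec p k - o.unitVec p k‖)) :=
    tendsto_finsetSum _ fun k _ => ((o.continuousAt_unitVec (h k)).sub continuousAt_const).norm
  simpa using this

theorem norm_velocity_isometry (o : EdgeOrientation G m)
    (g : EuclideanSpace ℝ (Fin d) ≃ᵃⁱ[ℝ] EuclideanSpace ℝ (Fin d)) (p : Configuration n d)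
    (ξ : Fin m → ℝ) : ‖o.velocity (fun i => g (p i)) ξ‖ = ‖o.velocity p ξ‖ := by
  have : ∀ i, o.velocity (fun i => g (p i)) ξ i = g.linearIsometryEquiv (o.velocity p ξ i) := by
    intro i
    simp only [velocity_apply, unitVec, relPos_isometry, LinearIsometryEquiv.norm_map, map_neg,
      map_sum, map_smul]
  simp only [Pi.norm_def, this, LinearIsometryEquiv.nnnorm_map]

/-! #### Rigidity -/

theorem linearIndependent_rigidityMatrix (o : EdgeOrientation G m) {p : Configuration n d}
    (h : o.IsInfinitesimallyMinimallyRigid p) : LinearIndependent ℝ (o.rigidityMatrix p).row := by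
  have hr : (o.rigidityMatrix p).rank = m := by
    obtain ⟨h1 | h1, h2 | h2⟩ := h <;> omega
  rw [linearIndependent_iff_card_eq_finrank_span, Set.finrank, ← Matrix.rank_eq_finrank_span_row,
    hr, Fintype.card_fin]

theorem relPos_ne_zero_of_rigid (o : EdgeOrientation G m) {p : Configuration n d}
    (h : o.IsInfinitesimallyMinimallyRigid p) (k : Fin m) : o.relPos p k ≠ 0 := by
  intro h0
  refine (o.linearIndependent_rigidityMatrix h).ne_zero k ?_
  funext ic
  simp [Matrix.row, rigidityMatrix, h0]

/-- The velocity is minus the transposed rigidity matrix applied to `ξ_k / ‖z_k‖`, and the rows of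
that matrix are independent. -/
theorem velocity_injective_of_rigid (o : EdgeOrientation G m) {p : Configuration n d}
    (h : o.IsInfinitesimallyMinimallyRigid p) : Function.Injective (o.velocity p) := by
  rw [injective_iff_map_eq_zero]
  intro ξ hξ
  have hz := o.relPos_ne_zero_of_rigid h
  have h1 := Fintype.linearIndependent_iff.1 (o.linearIndependent_rigidityMatrix h)
    (fun k => ξ k * ‖o.relPos p k‖⁻¹) (by
      funext ic
      have := congrFun (congrArg (WithLp.ofLp) (congrFun hξ ic.1)) ic.2
      simp only [velocity_apply, unitVec, Pi.zero_apply] at this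
      simp only [Finset.sum_apply, Pi.smul_apply, Matrix.row, rigidityMatrix, smul_eq_mul,
        Pi.zero_apply]
      simp only [PiLp.neg_apply, neg_eq_zero, PiLp.zero_apply, WithLp.ofLp_sum, Finset.sum_apply,
        PiLp.smul_apply, smul_eq_mul] at this
      rw [← this]
      exact Finset.sum_congr rfl fun k _ => by ring)
  funext k
  have := h1 k
  simpa [hz k] using this

/-- Near an infinitesimally and minimally rigid framework, and near its images under isometries,
no edge is degenerate and the velocity controls the signals uniformly. -/
theorem exists_velocity_lower_bound (o : EdgeOrientation G m) {pstar : Configuration n d}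
    (h : o.IsInfinitesimallyMinimallyRigid pstar) :
    ∃ r > 0, ∃ c > 0, ∀ g : EuclideanSpace ℝ (Fin d) ≃ᵃⁱ[ℝ] EuclideanSpace ℝ (Fin d),
      ∀ p ∈ Metric.ball (fun i => g (pstar i)) r,
        (∀ k, o.relPos p k ≠ 0) ∧ ∀ ξ, c * ‖ξ‖ ≤ ‖o.velocity p ξ‖ := by
  obtain ⟨K, hK, hKa⟩ := (o.velocity pstar).exists_antilipschitzWith
    (LinearMap.ker_eq_bot.2 (o.velocity_injective_of_rigid h))
  have hK' : (0 : ℝ) < K := hK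
  have hz := o.relPos_ne_zero_of_rigid h
  have e1 : ∀ᶠ p in 𝓝 pstar, ∀ k, o.relPos p k ≠ 0 :=
    eventually_all.2 fun k => (o.continuous_relPos k).continuousAt.eventually_ne (hz k)
  -- At `pstar` the lower bound is `K⁻¹`; half of it is given up to the variation of the unit
  -- vectors. Pulling back by `g` then makes `r` and `c` independent of the isometry.
  have e2 := (o.tendsto_sum_norm_unitVec_sub hz).eventually
    (gt_mem_nhds (show (0 : ℝ) < (K : ℝ)⁻¹ / 2 by positivity))
  obtain ⟨r, hr, hball⟩ := Metric.eventually_nhds_iff_ball.1 (e1.and e2)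
  refine ⟨r, hr, (K : ℝ)⁻¹ / 2, by positivity, fun g p hp => ?_⟩
  have hq : (fun i => g.symm (p i)) ∈ Metric.ball pstar r := by
    rw [Metric.mem_ball, dist_pi_lt_iff hr] at hp ⊢
    intro i
    rw [← g.dist_map, g.apply_symm_apply]
    exact hp i
  have hgp : p = fun i => g (g.symm (p i)) := by simp
  obtain ⟨h1, h2⟩ := hball _ hq
  constructor
  · intro k
    rw [hgp, relPos_isometry]
    simpa using h1 k
  · intro ξ
    rw [hgp, norm_velocity_isometry]
    have h3 := hKa.le_mul_dist ξ 0
    rw [map_zero, dist_zero_right, dist_zero_right] at h3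
    have h4 := o.norm_velocity_sub_le (fun i => g.symm (p i)) pstar ξ
    have h5 := mul_le_mul_of_nonneg_left h2.le (norm_nonneg ξ)
    have h6 := norm_sub_norm_le (o.velocity pstar ξ) (o.velocity (fun i => g.symm (p i)) ξ)
    rw [norm_sub_rev] at h6
    have h7 : (K : ℝ)⁻¹ * ‖ξ‖ ≤ ‖o.velocity pstar ξ‖ := by
      rw [inv_mul_le_iff₀ hK']; exact h3
    linarith

/-! #### The Filippov map of the controller -/

theorem abs_distError_sub_le (o : EdgeOrientation G m) (dist : Fin m → ℝ)
    (p q : Configuration n d) (k : Fin m) :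
    |o.distError dist p k - o.distError dist q k| ≤ 2 * Dist.dist p q := by
  simp only [distError, sub_sub_sub_cancel_right]
  exact (abs_norm_sub_norm_le _ _).trans (o.norm_relPos_sub_le p q k)

theorem continuous_distError (o : EdgeOrientation G m) (dist : Fin m → ℝ) (k : Fin m) :
    Continuous fun p : Configuration n d => o.distError dist p k :=
  (o.continuous_relPos k).norm.sub continuous_const

/-- Only the quantized signals jump; the unit vectors are continuous at `p`. So on small balls the
controller lies in any given thickening of the compact convex image of the subgradient box. -/
theorem exists_of_mem_filippovMap_controller (o : EdgeOrientation G m) {dist : Fin m → ℝ}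
    {δ : ℝ} (hδ : 0 < δ) {p v : Configuration n d} (hp : ∀ k, o.relPos p k ≠ 0)
    (hv : v ∈ filippovMap (o.controller (asymQuantizer δ) dist) p) :
    ∃ ξ : Fin m → ℝ, (∀ k, ξ k ∈ asymSubgradient δ (o.distError dist p k)) ∧
      v = o.velocity p ξ := by
  let B : Set (Fin m → ℝ) := pi univ fun k => asymSubgradient δ (o.distError dist p k)
  have hB : IsCompact B := isCompact_univ_pi fun k => isCompact_Icc
  have hBc : Convex ℝ B := convex_pi fun k _ => convex_Icc _ _
  have hK : IsCompact (o.velocity p '' B) :=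
    hB.image (o.velocity p).continuous_of_finiteDimensional
  have hKc : Convex ℝ (o.velocity p '' B) := hBc.linear_image _
  suffices v ∈ o.velocity p '' B by
    obtain ⟨ξ, hξ, rfl⟩ := this
    exact ⟨ξ, fun k => hξ k (mem_univ k), rfl⟩
  obtain ⟨R, hR⟩ := hB.isBounded.exists_norm_le
  rw [← hK.isClosed.closure_eq, Metric.closure_eq_iInter_cthickening]
  refine mem_iInter₂.2 fun η hη => ?_
  have e1 : ∀ᶠ y in 𝓝 p, ∀ k, asymQuantizer δ (o.distError dist y k) ∈
      asymSubgradient δ (o.distError dist p k) :=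
    eventually_all.2 fun k => (o.continuous_distError dist k).continuousAt.eventually
      (eventually_asymQuantizer_mem hδ _)
  have e2 := (o.tendsto_sum_norm_unitVec_sub hp).eventually
    (gt_mem_nhds (show (0 : ℝ) < η / (|R| + 1) by positivity))
  obtain ⟨r, hr, hball⟩ := Metric.eventually_nhds_iff_ball.1 (e1.and e2)
  refine filippovMap_subset_of_forall_ball hr (hKc.cthickening η) Metric.isClosed_cthickening
    (fun y hy => ?_) hv
  obtain ⟨h1, h2⟩ := hball y hy
  have hmem : (fun k => asymQuantizer δ (o.distError dist y k)) ∈ B := fun k _ => h1 k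
  refine Metric.mem_cthickening_of_dist_le _ _ _ _ (mem_image_of_mem (o.velocity p) hmem) ?_
  rw [controller_eq_velocity, dist_eq_norm]
  refine (o.norm_velocity_sub_le _ _ _).trans ?_
  calc _ ≤ (|R| + 1) * (η / (|R| + 1)) := by
        gcongr
        exact (hR _ hmem).trans ((le_abs_self R).trans (by linarith))
    _ = η := by field_simp

theorem norm_controller_le (o : EdgeOrientation G m) {dist : Fin m → ℝ} {δ a : ℝ} (hδ : 0 < δ)
    {p : Configuration n d} (hp : ∀ k, |o.distError dist p k| ≤ a) :
    ‖o.controller (asymQuantizer δ) dist p‖ ≤ m * (a + δ) := by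
  rw [controller_eq_velocity]
  refine (o.norm_velocity_le _ _).trans ?_
  refine (Finset.sum_le_card_nsmul _ _ (a + δ) fun k _ => ?_).trans_eq ?_
  · exact (abs_asymQuantizer_le hδ _).trans (by linarith [hp k])
  · simp [mul_add]

/-! #### The Lyapunov function -/

/-- The sum over all edges of the potential of the quantizer at the distance error. -/
def potential (o : EdgeOrientation G m) (δ : ℝ) (dist : Fin m → ℝ) (p : Configuration n d) : ℝ :=
  ∑ k, asymPotential δ (o.distError dist p k)

theorem potential_nonneg (o : EdgeOrientation G m) {δ : ℝ} (hδ : 0 < δ) (dist : Fin m → ℝ)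
    (p : Configuration n d) : 0 ≤ o.potential δ dist p :=
  Finset.sum_nonneg fun _ _ => asymPotential_nonneg hδ _

theorem potential_eq_zero_iff (o : EdgeOrientation G m) {δ : ℝ} (hδ : 0 < δ) (dist : Fin m → ℝ)
    (p : Configuration n d) :
    o.potential δ dist p = 0 ↔ o.distError dist p ∈ asymErrorSet m δ := by
  rw [potential, Finset.sum_eq_zero_iff_of_nonneg fun _ _ => asymPotential_nonneg hδ _]
  simp [asymErrorSet, ← asymPotential_eq_zero_iff hδ]

theorem potential_le (o : EdgeOrientation G m) {δ a : ℝ} (hδ : 0 < δ) (dist : Fin m → ℝ)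
    {p : Configuration n d} (hp : ∀ k, |o.distError dist p k| ≤ a) (ha : 0 ≤ a) :
    o.potential δ dist p ≤ m * ((a + δ) * a) := by
  refine (Finset.sum_le_card_nsmul _ _ ((a + δ) * a) fun k _ => ?_).trans_eq (by simp)
  refine (asymPotential_le_abs hδ _).trans ?_
  have := hp k
  gcongr

theorem lipschitzOnWith_potential (o : EdgeOrientation G m) {δ a : ℝ} (hδ : 0 < δ) (ha : 0 ≤ a)
    (dist : Fin m → ℝ) :
    LipschitzOnWith (m * ((a + δ) * 2)).toNNReal
      (o.potential (d := d) δ dist) {p | ∀ k, |o.distError dist p k| ≤ a} := by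
  refine LipschitzOnWith.of_dist_le_mul fun p hp q hq => ?_
  rw [Real.coe_toNNReal _ (by positivity), Real.dist_eq, potential, potential,
    ← Finset.sum_sub_distrib]
  refine (Finset.abs_sum_le_sum_abs _ _).trans ?_
  refine (Finset.sum_le_card_nsmul _ _ ((a + δ) * (2 * Dist.dist p q)) fun k _ => ?_).trans_eq ?_
  · refine (abs_asymPotential_sub_le hδ (hp k) (hq k)).trans ?_
    gcongr
    exact o.abs_distError_sub_le dist p q k
  · simp; ring

theorem hasDerivAt_distError (o : EdgeOrientation G m) (dist : Fin m → ℝ)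
    {p : ℝ → Configuration n d} {v : Configuration n d} {t : ℝ} (hp : HasDerivAt p v t)
    {k : Fin m} (hz : o.relPos (p t) k ≠ 0) :
    HasDerivAt (fun s => o.distError dist (p s) k)
      (inner ℝ (o.unitVec (p t) k) (o.relPos v k)) t := by
  have h1 : HasDerivAt (fun s => o.relPos (p s) k) (o.relPos v k) t := by
    simp only [relPos_eq]
    exact (hasDerivAt_pi.1 hp _).sub (hasDerivAt_pi.1 hp _)
  have h2 := (h1.norm_sq.sqrt (by positivity)).sub_const (dist k)
  have h3 : (fun s => √(‖o.relPos (p s) k‖ ^ 2) - dist k) =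
      fun s => o.distError dist (p s) k := by
    funext s; rw [Real.sqrt_sq (norm_nonneg _)]; rfl
  rw [h3] at h2
  refine h2.congr_deriv ?_
  rw [Real.sqrt_sq (norm_nonneg _), unitVec, real_inner_smul_left]
  have := norm_ne_zero_iff.2 hz
  field_simp

/-- Adjointness of `velocity p` and the derivative of the distance errors, up to sign. -/
theorem sum_mul_inner_unitVec_velocity (o : EdgeOrientation G m) (p : Configuration n d)
    (ξ : Fin m → ℝ) :
    ∑ k, ξ k * inner ℝ (o.unitVec p k) (o.relPos (o.velocity p ξ) k) =
      -∑ i, ‖o.velocity p ξ i‖ ^ 2 := by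
  set v := o.velocity p ξ with hv
  have h1 : ∀ i, ‖v i‖ ^ 2 =
      -∑ k, (o.incidence i k * ξ k) * inner ℝ (o.unitVec p k) (v i) := by
    intro i
    rw [← real_inner_self_eq_norm_sq]
    conv_lhs => enter [2]; rw [hv, velocity_apply]
    rw [inner_neg_left, sum_inner]
    simp only [real_inner_smul_left]
  simp only [h1, relPos, inner_sum, real_inner_smul_right, Finset.mul_sum]
  rw [Finset.sum_neg_distrib, neg_neg, Finset.sum_comm]
  exact Finset.sum_congr rfl fun i _ => Finset.sum_congr rfl fun k _ => by ring

end EdgeOrientation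

/-! ### A priori estimates along Filippov solutions -/

/-- Configurations carry the sup norm, whereas the dissipation is a Euclidean sum of squares. -/
theorem sq_pi_norm_le_sum_sq {ι : Type*} [Fintype ι] {F : ι → Type*}
    [∀ i, SeminormedAddCommGroup (F i)] (v : ∀ i, F i) : ‖v‖ ^ 2 ≤ ∑ i, ‖v i‖ ^ 2 := by
  have h : ‖v‖ ≤ √(∑ i, ‖v i‖ ^ 2) := by
    refine (pi_norm_le_iff_of_nonneg (Real.sqrt_nonneg _)).2 fun i => Real.le_sqrt_of_sq_le ?_
    exact Finset.single_le_sum (f := fun i => ‖v i‖ ^ 2) (fun _ _ => by positivity)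
      (Finset.mem_univ i)
  calc ‖v‖ ^ 2 ≤ √(∑ i, ‖v i‖ ^ 2) ^ 2 := by gcongr
    _ = _ := Real.sq_sqrt (Finset.sum_nonneg fun _ _ => by positivity)

/-- The shift by `δ²` removes the singularity of the root at zero, so that `√(V + δ²)` is absolutely
continuous along solutions. -/
theorem lipschitzOnWith_sqrt_add_sq {δ : ℝ} (hδ : 0 < δ) :
    LipschitzOnWith δ⁻¹.toNNReal (fun y => √(y + δ ^ 2)) (Ici 0) := by
  refine LipschitzOnWith.of_dist_le_mul fun x hx y hy => ?_
  rw [mem_Ici] at hx hy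
  rw [Real.coe_toNNReal _ (by positivity), Real.dist_eq, Real.dist_eq]
  have h1 : δ ≤ √(x + δ ^ 2) := Real.le_sqrt_of_sq_le (by linarith)
  have h2 : δ ≤ √(y + δ ^ 2) := Real.le_sqrt_of_sq_le (by linarith)
  have h3 : x - y = (√(x + δ ^ 2) - √(y + δ ^ 2)) * (√(x + δ ^ 2) + √(y + δ ^ 2)) := by
    have := Real.sq_sqrt (show 0 ≤ x + δ ^ 2 by positivity)
    have := Real.sq_sqrt (show 0 ≤ y + δ ^ 2 by positivity)
    ring_nf at *
    linarith
  rw [h3, abs_mul, abs_of_pos (show 0 < √(x + δ ^ 2) + √(y + δ ^ 2) by linarith)]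
  rw [le_inv_mul_iff₀ hδ, mul_comm]
  exact mul_le_mul_of_nonneg_left (by linarith) (abs_nonneg _)

namespace EdgeOrientation

variable {n m d : ℕ} {G : SimpleGraph (Fin n)}

/-- On the region `W` no edge is degenerate, the velocity controls the signals with constant `c`,
and the distance errors are at most `a`. -/
structure IsRigidRegion (o : EdgeOrientation G m) (dist : Fin m → ℝ) (c a : ℝ)
    (W : Set (Configuration n d)) : Prop where
  relPos_ne_zero : ∀ p ∈ W, ∀ k, o.relPos p k ≠ 0
  le_norm_velocity : ∀ p ∈ W, ∀ ξ, c * ‖ξ‖ ≤ ‖o.velocity p ξ‖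
  abs_distError_le : ∀ p ∈ W, ∀ k, |o.distError dist p k| ≤ a

variable {o : EdgeOrientation G m} {dist : Fin m → ℝ} {c a δ : ℝ} {W : Set (Configuration n d)}

/-- The second bound controls the distance travelled, the third the time needed to reach the target
set. -/
theorem IsRigidRegion.deriv_potential (hW : o.IsRigidRegion dist c a W) (hc : 0 < c) (hδ : 0 < δ)
    {p : ℝ → Configuration n d} {v : Configuration n d} {t w : ℝ} (hpW : p t ∈ W)
    (hv : v ∈ filippovMap (o.controller (asymQuantizer δ) dist) (p t)) (hp : HasDerivAt p v t)
    (hw : HasDerivAt (fun s => o.potential δ dist (p s)) w t) :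
    w ≤ 0 ∧ w ≤ -(c / (2 * m + 1) * √(o.potential δ dist (p t) + δ ^ 2) * ‖v‖) ∧
      (o.potential δ dist (p t) ≠ 0 → w ≤ -(c ^ 2 * δ ^ 2)) := by
  have hz := hW.relPos_ne_zero _ hpW
  obtain ⟨ξ, hξ, rfl⟩ := o.exists_of_mem_filippovMap_controller hδ hz hv
  set v := o.velocity (p t) ξ
  have hV0 := o.potential_nonneg hδ dist (p t)
  have hw1 : w = -∑ i, ‖v i‖ ^ 2 := by
    rw [← o.sum_mul_inner_unitVec_velocity]
    -- No nonsmooth chain rule is needed: by the subgradient inequality `V - ∑ ξ_k e_k`, with `ξ`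
    -- frozen, has a minimum along the curve at `t`, so its derivative vanishes there.
    have hd : HasDerivAt
        (fun s => o.potential δ dist (p s) - ∑ k, ξ k * o.distError dist (p s) k)
        (w - ∑ k, ξ k * inner ℝ (o.unitVec (p t) k) (o.relPos v k)) t :=
      hw.sub (HasDerivAt.fun_sum fun k _ => (o.hasDerivAt_distError dist hp (hz k)).const_mul _)
    have hmin : IsLocalMin
        (fun s => o.potential δ dist (p s) - ∑ k, ξ k * o.distError dist (p s) k) t := by
      refine Filter.Eventually.of_forall fun s => ?_
      simp only [potential, ← Finset.sum_sub_distrib]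
      refine Finset.sum_le_sum fun k _ => ?_
      have := asymPotential_subgradient hδ (hξ k) (o.distError dist (p s) k)
      linarith
    linarith [hmin.hasDerivAt_eq_zero hd]
  have hw2 : w ≤ -‖v‖ ^ 2 := by linarith [sq_pi_norm_le_sum_sq v]
  refine ⟨by nlinarith, ?_⟩
  -- At a zero of `V` the signals may vanish, so there is no lower bound on the speed; but there `V`
  -- is minimal, hence `w = 0` and `v = 0`.
  by_cases hV : o.potential δ dist (p t) = 0
  · have hmin : IsLocalMin (fun s => o.potential δ dist (p s)) t :=
      Filter.Eventually.of_forall fun s => by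
        show o.potential δ dist (p t) ≤ _
        rw [hV]; exact o.potential_nonneg hδ dist _
    have hw0 := hmin.hasDerivAt_eq_zero hw
    have hv0 : ‖v‖ = 0 := by
      rw [← sq_eq_zero_iff]
      exact le_antisymm (by linarith) (sq_nonneg _)
    exact ⟨by rw [hw0, hv0]; simp, fun h => (h hV).elim⟩
  · obtain ⟨k, hk⟩ : ∃ k, o.distError dist (p t) k ∉ Icc 0 δ := by
      by_contra! h
      exact hV ((o.potential_eq_zero_iff hδ dist _).2 h)
    have hξδ : δ ≤ ‖ξ‖ :=
      (le_abs_of_mem_asymSubgradient hδ (hξ k) hk).1.trans (norm_le_pi_norm ξ k)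
    have hcv := hW.le_norm_velocity _ hpW ξ
    have hVξ : o.potential δ dist (p t) ≤ 2 * m * ‖ξ‖ ^ 2 := by
      refine (Finset.sum_le_card_nsmul _ _ (2 * ‖ξ‖ ^ 2) fun k _ => ?_).trans_eq
        (by simp; ring)
      refine (asymPotential_le_sq hδ (hξ k)).trans ?_
      have := norm_le_pi_norm ξ k
      rw [← sq_abs, ← Real.norm_eq_abs]
      gcongr
    -- `V + δ² ≤ (2m + 1) ‖ξ‖² ≤ (2m + 1)² ‖ξ‖²`, using `δ ≤ ‖ξ‖`.
    have hs : c / (2 * m + 1) * √(o.potential δ dist (p t) + δ ^ 2) ≤ ‖v‖ := by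
      refine le_trans ?_ hcv
      rw [div_mul_eq_mul_div, mul_div_assoc]
      refine mul_le_mul_of_nonneg_left ?_ hc.le
      rw [div_le_iff₀ (by positivity)]
      refine Real.sqrt_le_iff.2 ⟨by positivity, ?_⟩
      have h1 : δ ^ 2 ≤ ‖ξ‖ ^ 2 := by gcongr
      have h2 : (0 : ℝ) ≤ m * ‖ξ‖ ^ 2 := by positivity
      have h3 : (0 : ℝ) ≤ m ^ 2 * ‖ξ‖ ^ 2 := by positivity
      nlinarith
    constructor
    · have := mul_le_mul_of_nonneg_right hs (norm_nonneg v)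
      nlinarith
    · intro _
      have : (c * δ) ^ 2 ≤ ‖v‖ ^ 2 := by
        gcongr
        exact (mul_le_mul_of_nonneg_left hξδ hc.le).trans hcv
      nlinarith

theorem IsRigidRegion.absolutelyContinuousOnInterval_potential (hW : o.IsRigidRegion dist c a W)
    (ha : 0 ≤ a) (hδ : 0 < δ) {p : ℝ → Configuration n d} {s t : ℝ}
    (hac : AbsolutelyContinuousOnInterval p s t) (hpW : ∀ x ∈ uIcc s t, p x ∈ W) :
    AbsolutelyContinuousOnInterval (fun x => o.potential δ dist (p x)) s t :=
  AbsolutelyContinuousOnInterval.comp_lipschitzOnWith (o.lipschitzOnWith_potential hδ ha dist) hac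
    fun x hx => hW.abs_distError_le _ (hpW x hx)

/-- The distance travelled is controlled by the loss of potential. -/
theorem IsRigidRegion.dist_le (hW : o.IsRigidRegion dist c a W) (hc : 0 < c) (ha : 0 ≤ a)
    (hδ : 0 < δ) {p : ℝ → Configuration n d} {s t : ℝ} (hst : s ≤ t)
    (hac : AbsolutelyContinuousOnInterval p s t) (hpW : ∀ x ∈ Icc s t, p x ∈ W)
    (hp : ∀ᵐ x : ℝ, x ∈ Ioo s t →
      ∃ v ∈ filippovMap (o.controller (asymQuantizer δ) dist) (p x), HasDerivAt p v x) :
    c / (2 * m + 1) / 2 * Dist.dist (p t) (p s) ≤ √(o.potential δ dist (p s)) := by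
  set κ := c / (2 * m + 1) with hκ
  have hκ0 : 0 < κ := by positivity
  rw [← uIcc_of_le hst] at hpW
  have hVac := hW.absolutelyContinuousOnInterval_potential ha hδ hac hpW
  have hSac := AbsolutelyContinuousOnInterval.comp_lipschitzOnWith (lipschitzOnWith_sqrt_add_sq hδ)
    hVac fun x _ => o.potential_nonneg hδ dist (p x)
  obtain ⟨φ, hφ, hφ2⟩ := exists_dual_vector'' ℝ (p t - p s)
  have hφac : AbsolutelyContinuousOnInterval (fun x => φ (p x)) s t :=
    AbsolutelyContinuousOnInterval.comp_lipschitzOnWith (s := univ)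
      (φ.lipschitz.lipschitzOnWith) hac fun _ _ => mem_univ _
  have key := ((hφac.const_mul (κ / 2)).add hSac).le_of_ae_deriv_nonpos hst (by
    filter_upwards [hp, hVac.ae_differentiableAt] with x hx hxd hmem
    obtain ⟨v, hv, hd⟩ := hx hmem
    have hmem' : x ∈ uIcc s t := by rw [uIcc_of_le hst]; exact Ioo_subset_Icc_self hmem
    have hw := (hxd hmem').hasDerivAt
    set w := deriv (fun x => o.potential δ dist (p x)) x
    have hV := o.potential_nonneg hδ dist (p x)
    have hpos : 0 < o.potential δ dist (p x) + δ ^ 2 := by positivity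
    refine ⟨κ / 2 * φ v + w / (2 * √(o.potential δ dist (p x) + δ ^ 2)), ?_, ?_⟩
    · have h1 := (hW.deriv_potential hc hδ (hpW x hmem') hv hd hw).2.1
      rw [← hκ] at h1
      have h2 : φ v ≤ ‖φ‖ * ‖v‖ := (le_abs_self _).trans (φ.le_opNorm v)
      have h3 : ‖φ‖ * ‖v‖ ≤ 1 * ‖v‖ := by gcongr
      have h4 : 0 < √(o.potential δ dist (p x) + δ ^ 2) := Real.sqrt_pos.2 hpos
      have h5 : w / (2 * √(o.potential δ dist (p x) + δ ^ 2)) ≤ -(κ / 2 * ‖v‖) := by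
        rw [div_le_iff₀ (by positivity)]
        linarith
      have h6 : κ / 2 * φ v ≤ κ / 2 * ‖v‖ := by
        refine mul_le_mul_of_nonneg_left (by linarith) (by positivity)
      linarith
    · exact ((φ.hasFDerivAt.comp_hasDerivAt x hd).const_mul (κ / 2)).add
        ((hw.add_const (δ ^ 2)).sqrt hpos.ne'))
  simp only [Pi.add_apply] at key
  have h1 : φ (p t - p s) = ‖p t - p s‖ := by simpa using hφ2
  rw [map_sub, ← dist_eq_norm] at h1
  -- The `δ` gained at the final time cancels the one lost in `h3`, leaving a bound by `√V` without
  -- the shift.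
  have h2 : δ ≤ √(o.potential δ dist (p t) + δ ^ 2) :=
    Real.le_sqrt_of_sq_le (by linarith [o.potential_nonneg hδ dist (p t)])
  have h3 : √(o.potential δ dist (p s) + δ ^ 2) ≤ √(o.potential δ dist (p s)) + δ := by
    have := o.potential_nonneg hδ dist (p s)
    refine Real.sqrt_le_iff.2 ⟨by positivity, ?_⟩
    have h4 := Real.sq_sqrt this
    have h5 : 0 ≤ √(o.potential δ dist (p s)) * δ := by positivity
    nlinarith
  rw [← h1]
  linarith

theorem IsRigidRegion.potential_antitone (hW : o.IsRigidRegion dist c a W) (hc : 0 < c)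
    (ha : 0 ≤ a) (hδ : 0 < δ) {p : ℝ → Configuration n d} {s t : ℝ} (hst : s ≤ t)
    (hac : AbsolutelyContinuousOnInterval p s t) (hpW : ∀ x ∈ Icc s t, p x ∈ W)
    (hp : ∀ᵐ x : ℝ, x ∈ Ioo s t →
      ∃ v ∈ filippovMap (o.controller (asymQuantizer δ) dist) (p x), HasDerivAt p v x) :
    o.potential δ dist (p t) ≤ o.potential δ dist (p s) := by
  rw [← uIcc_of_le hst] at hpW
  have hVac := hW.absolutelyContinuousOnInterval_potential ha hδ hac hpW
  refine hVac.le_of_ae_deriv_nonpos hst ?_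
  filter_upwards [hp, hVac.ae_differentiableAt] with x hx hxd hmem
  obtain ⟨v, hv, hd⟩ := hx hmem
  have hmem' : x ∈ uIcc s t := by rw [uIcc_of_le hst]; exact Ioo_subset_Icc_self hmem
  have hw := (hxd hmem').hasDerivAt
  exact ⟨_, (hW.deriv_potential hc hδ (hpW x hmem') hv hd hw).1, hw⟩

/-- As long as the potential is positive, it decreases at least at a fixed rate. -/
theorem IsRigidRegion.potential_add_le (hW : o.IsRigidRegion dist c a W) (hc : 0 < c)
    (ha : 0 ≤ a) (hδ : 0 < δ) {p : ℝ → Configuration n d} {s t : ℝ} (hst : s ≤ t)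
    (hac : AbsolutelyContinuousOnInterval p s t) (hpW : ∀ x ∈ Icc s t, p x ∈ W)
    (hp : ∀ᵐ x : ℝ, x ∈ Ioo s t →
      ∃ v ∈ filippovMap (o.controller (asymQuantizer δ) dist) (p x), HasDerivAt p v x)
    (hV : ∀ x ∈ Icc s t, o.potential δ dist (p x) ≠ 0) :
    o.potential δ dist (p t) + c ^ 2 * δ ^ 2 * (t - s) ≤ o.potential δ dist (p s) := by
  rw [← uIcc_of_le hst] at hpW
  have hVac := hW.absolutelyContinuousOnInterval_potential ha hδ hac hpW
  have hid : AbsolutelyContinuousOnInterval (fun x : ℝ => c ^ 2 * δ ^ 2 * x) s t :=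
    AbsolutelyContinuousOnInterval.const_mul _ (f := fun x => x)
      (LipschitzWith.id.lipschitzOnWith).absolutelyContinuousOnInterval
  have key := (hVac.add hid).le_of_ae_deriv_nonpos hst (by
    filter_upwards [hp, hVac.ae_differentiableAt] with x hx hxd hmem
    obtain ⟨v, hv, hd⟩ := hx hmem
    have hmem' : x ∈ uIcc s t := by rw [uIcc_of_le hst]; exact Ioo_subset_Icc_self hmem
    have hw := (hxd hmem').hasDerivAt
    refine ⟨_, ?_, hw.add ((hasDerivAt_id x).const_mul (c ^ 2 * δ ^ 2))⟩
    have := (hW.deriv_potential hc hδ (hpW x hmem') hv hd hw).2.2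
      (hV x (Ioo_subset_Icc_self hmem))
    linarith)
  simp only [Pi.add_apply] at key
  linarith

/-- A curve that starts near the centre of a rigid ball with small potential, and solves the
differential inclusion while in the ball, does not leave the ball. -/
theorem IsRigidRegion.mem_ball {P : Configuration n d} {r : ℝ}
    (hW : o.IsRigidRegion dist c a (Metric.ball P r)) (hc : 0 < c) (ha : 0 ≤ a) (hδ : 0 < δ)
    {p : ℝ → Configuration n d} {T : ℝ} (hac : AbsolutelyContinuousOnInterval p 0 T)
    (hp : ∀ᵐ x : ℝ, x ∈ Ioo 0 T → p x ∈ Metric.ball P r →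
      ∃ v ∈ filippovMap (o.controller (asymQuantizer δ) dist) (p x), HasDerivAt p v x)
    (h0 : Dist.dist (p 0) P + √(o.potential δ dist (p 0)) / (c / (2 * m + 1) / 2) < r) :
    ∀ t ∈ Icc 0 T, p t ∈ Metric.ball P r := by
  by_contra! hbad
  obtain ⟨t₁, ht₁, hbad₁⟩ := hbad
  have hT : 0 ≤ T := ht₁.1.trans ht₁.2
  have hcont : ContinuousOn p (Icc 0 T) := by
    have := hac.continuousOn
    rwa [uIcc_of_le hT] at this
  have hclosed : IsCompact (Icc 0 T ∩ p ⁻¹' (Metric.ball P r)ᶜ) :=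
    isCompact_Icc.of_isClosed_subset
      (hcont.preimage_isClosed_of_isClosed isClosed_Icc Metric.isOpen_ball.isClosed_compl)
      inter_subset_left
  -- First exit time. The travel bound holds before `t₀` and passes to the limit, with a value
  -- strictly below `r`.
  obtain ⟨t₀, ⟨ht₀, hbad₀⟩, hmin⟩ := hclosed.exists_isLeast ⟨t₁, ht₁, hbad₁⟩
  have hin : ∀ s ∈ Ico 0 t₀, p s ∈ Metric.ball P r := fun s hs => by
    by_contra h
    exact (hmin ⟨⟨hs.1, hs.2.le.trans ht₀.2⟩, h⟩).not_gt hs.2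
  set κ := c / (2 * m + 1) / 2
  have hκ : 0 < κ := by positivity
  have hdist : ∀ s ∈ Ico 0 t₀, Dist.dist (p s) P ≤
      Dist.dist (p 0) P + √(o.potential δ dist (p 0)) / κ := by
    intro s hs
    have hsT : s ≤ T := hs.2.le.trans ht₀.2
    have hsub : ∀ x ∈ Icc 0 s, p x ∈ Metric.ball P r := fun x hx =>
      hin x ⟨hx.1, hx.2.trans_lt hs.2⟩
    have h1 := hW.dist_le hc ha hδ hs.1
      (hac.mono (by rw [uIcc_of_le hs.1, uIcc_of_le hT]; exact Icc_subset_Icc_right hsT)) hsub (by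
        filter_upwards [hp] with x hx hmem
        exact hx ⟨hmem.1, hmem.2.trans_le hsT⟩ (hsub x (Ioo_subset_Icc_self hmem)))
    have h2 : Dist.dist (p s) (p 0) ≤ √(o.potential δ dist (p 0)) / κ := by
      rw [le_div_iff₀ hκ, mul_comm]; exact h1
    linarith [dist_triangle (p s) (p 0) P]
  have hpos : 0 < t₀ := by
    refine lt_of_le_of_ne ht₀.1 fun h => hbad₀ ?_
    rw [← h, Metric.mem_ball]
    have : 0 ≤ √(o.potential δ dist (p 0)) / κ := by positivity
    linarith
  have hlim : Filter.Tendsto p (nhdsWithin t₀ (Ico 0 t₀)) (nhds (p t₀)) :=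
    (hcont t₀ ht₀).mono_left (nhdsWithin_mono _ fun x hx => ⟨hx.1, hx.2.le.trans ht₀.2⟩)
  have : (nhdsWithin t₀ (Ico 0 t₀)).NeBot := by
    rw [nhdsWithin_Ico_eq_nhdsLT hpos]; infer_instance
  have h3 : Dist.dist (p t₀) P ≤ Dist.dist (p 0) P + √(o.potential δ dist (p 0)) / κ :=
    le_of_tendsto (hlim.dist tendsto_const_nhds)
      (Filter.eventually_of_mem self_mem_nhdsWithin hdist)
  exact hbad₀ (Metric.mem_ball.2 (h3.trans_lt h0))

theorem IsRigidRegion.exists_potential_eq_zero (hW : o.IsRigidRegion dist c a W) (hc : 0 < c)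
    (ha : 0 ≤ a) (hδ : 0 < δ) {p : ℝ → Configuration n d}
    (hp : IsFilippovSolution (o.controller (asymQuantizer δ) dist) (Ici 0) p)
    (hpW : ∀ x, 0 ≤ x → p x ∈ W) :
    ∃ T, 0 ≤ T ∧ ∀ t, T ≤ t → o.potential δ dist (p t) = 0 := by
  have hae : ∀ s t, 0 ≤ s → ∀ᵐ x : ℝ, x ∈ Ioo s t →
      ∃ v ∈ filippovMap (o.controller (asymQuantizer δ) dist) (p x), HasDerivAt p v x := by
    intro s t hs
    filter_upwards [hp.2] with x hx hmem
    exact hx (hs.trans hmem.1.le)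
  obtain ⟨T, hT, hVT⟩ : ∃ T, 0 ≤ T ∧ o.potential δ dist (p T) = 0 := by
    by_contra! h
    -- By this time a positive `V` would have lost more than its initial value.
    set T := (o.potential δ dist (p 0) + 1) / (c ^ 2 * δ ^ 2)
    have hT : 0 ≤ T := div_nonneg (by linarith [o.potential_nonneg hδ dist (p 0)]) (by positivity)
    have h1 := hW.potential_add_le hc ha hδ hT (hp.1 0 (mem_Ici.2 le_rfl) T hT)
      (fun x hx => hpW x hx.1) (hae 0 T le_rfl) (fun x hx => h x hx.1)
    have h2 : c ^ 2 * δ ^ 2 * (T - 0) = o.potential δ dist (p 0) + 1 := by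
      rw [sub_zero]; exact mul_div_cancel₀ _ (by positivity)
    linarith [o.potential_nonneg hδ dist (p T)]
  refine ⟨T, hT, fun t ht => le_antisymm ?_ (o.potential_nonneg hδ dist _)⟩
  rw [← hVT]
  exact hW.potential_antitone hc ha hδ ht (hp.1 T hT t (hT.trans ht))
    (fun x hx => hpW x (hT.trans hx.1)) (hae T t hT)

end EdgeOrientation

/-! ### Concatenation and extension of solutions -/

theorem LipschitzWith.concat {E : Type*} [PseudoMetricSpace E] {f g : ℝ → E} {K : NNReal}
    (hf : LipschitzWith K f) (hg : LipschitzWith K g) {τ : ℝ} (h : f τ = g τ) :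
    LipschitzWith K fun t => if t < τ then f t else g t := by
  have aux : ∀ s t, s ≤ t → dist (if s < τ then f s else g s) (if t < τ then f t else g t) ≤
      K * dist s t := by
    intro s t hst
    by_cases h1 : s < τ <;> by_cases h2 : t < τ
    · simpa [h1, h2] using hf.dist_le_mul s t
    · rw [if_pos h1, if_neg h2]
      have h3 := hf.dist_le_mul s τ
      have h4 := hg.dist_le_mul τ t
      rw [← h] at h4
      rw [not_lt] at h2
      rw [dist_comm s τ, Real.dist_eq, abs_of_nonneg (by linarith)] at h3
      rw [dist_comm τ t, Real.dist_eq, abs_of_nonneg (by linarith)] at h4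
      rw [dist_comm s t, Real.dist_eq, abs_of_nonneg (by linarith)]
      linarith [dist_triangle (f s) (f τ) (g t)]
    · exact absurd (hst.trans_lt h2) h1
    · simpa [h1, h2] using hg.dist_le_mul s t
  refine LipschitzWith.of_dist_le_mul fun s t => ?_
  rcases le_total s t with hst | hst
  · exact aux s t hst
  · rw [dist_comm, dist_comm s]; exact aux t s hst

/-- A Lipschitz Filippov solution on `[0, τ)` can be continued, as a curve that solves the
differential inclusion while it is in a given open set on which the vector field is bounded. -/
theorem exists_lipschitz_filippov_extension {E : Type*} [NormedAddCommGroup E] [NormedSpace ℝ E]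
    [MeasureSpace E] [FiniteDimensional ℝ E] [(volume : Measure E).IsOpenPosMeasure] {X : E → E}
    {U : Set E} (hU : IsOpen U) {M : ℝ} (hM0 : 0 ≤ M) (hM : ∀ x ∈ U, ‖X x‖ ≤ M) {τ : ℝ}
    {p : ℝ → E} {K : NNReal} (hpK : LipschitzOnWith K p (Ico 0 τ))
    (hp : ∀ᵐ t : ℝ, t ∈ Ico 0 τ → ∃ v ∈ filippovMap X (p t), HasDerivAt p v t) :
    ∃ (q : ℝ → E) (L : NNReal), LipschitzWith L q ∧ EqOn q p (Ico 0 τ) ∧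
      ∀ᵐ t : ℝ, 0 < t → q t ∈ U → ∃ v ∈ filippovMap X (q t), HasDerivAt q v t := by
  -- The extension supplies the endpoint value `g τ`, from which the continuation starts.
  obtain ⟨g, hgL, hgp⟩ := hpK.extend_finite_dimension
  obtain ⟨q, hqL, hq0, hq⟩ := exists_lipschitz_filippov hU hM0 hM (g τ)
  set K' := max (lipschitzExtensionConstant E * K) M.toNNReal
  have hshift : LipschitzWith K' fun t => q (t - τ) := by
    have h1 : LipschitzWith 1 fun t : ℝ => t - τ :=
      LipschitzWith.of_dist_le_mul fun s t => by simp
    have h2 := hqL.comp h1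
    rw [mul_one] at h2
    exact h2.weaken (le_max_right _ _)
  have hq' : ∀ᵐ t : ℝ, 0 < t - τ → q (t - τ) ∈ U →
      ∃ v ∈ filippovMap X (q (t - τ)), HasDerivAt q v (t - τ) :=
    (measurePreserving_sub_right volume τ).quasiMeasurePreserving.ae hq
  refine ⟨fun t => if t < τ then g t else q (t - τ), K',
    (hgL.weaken (le_max_left _ _)).concat hshift (by simp [hq0]), ?_, ?_⟩
  · intro t ht
    simp only [ht.2, if_true]
    exact (hgp ht).symm
  · filter_upwards [hp, hq', Measure.ae_ne volume τ] with t h1 h2 hne ht0 hU'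
    rcases lt_or_gt_of_ne hne with h | h
    · obtain ⟨v, hv, hd⟩ := h1 ⟨ht0.le, h⟩
      refine ⟨v, ?_, hd.congr_of_eventuallyEq ?_⟩
      · rw [if_pos h, ← hgp ⟨ht0.le, h⟩]; exact hv
      · filter_upwards [Ioo_mem_nhds ht0 h] with s hs
        rw [if_pos hs.2, hgp ⟨hs.1.le, hs.2⟩]
    · rw [if_neg h.not_gt] at hU' ⊢
      obtain ⟨v, hv, hd⟩ := h2 (sub_pos.2 h) hU'
      refine ⟨v, hv, (hd.comp_sub_const t τ).congr_of_eventuallyEq ?_⟩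
      filter_upwards [Ioi_mem_nhds h] with s hs
      rw [if_neg (not_lt.2 (le_of_lt hs))]

theorem LipschitzWith.isFilippovSolution {E : Type*} [NormedAddCommGroup E] [NormedSpace ℝ E]
    [MeasureSpace E] {X : E → E} {q : ℝ → E} {L : NNReal} (hq : LipschitzWith L q)
    (h : ∀ᵐ t : ℝ, 0 < t → ∃ v ∈ filippovMap X (q t), HasDerivAt q v t) :
    IsFilippovSolution X (Ici 0) q := by
  refine ⟨fun a _ b _ => hq.lipschitzOnWith.absolutelyContinuousOnInterval, ?_⟩
  filter_upwards [h, Measure.ae_ne volume (0 : ℝ)] with t ht hne ht0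
  exact ht (lt_of_le_of_ne ht0 hne.symm)

theorem IsFilippovSolution.lipschitzOnWith {E : Type*} [NormedAddCommGroup E] [NormedSpace ℝ E]
    [MeasureSpace E] {X : E → E} {J : Set ℝ} [J.OrdConnected] {p : ℝ → E}
    (hp : IsFilippovSolution X J p) {U : Set E} (hU : IsOpen U) {M : ℝ} (hM0 : 0 ≤ M)
    (hM : ∀ x ∈ U, ‖X x‖ ≤ M) (hpU : ∀ t ∈ J, p t ∈ U) : LipschitzOnWith M.toNNReal p J := by
  have aux : ∀ s ∈ J, ∀ t ∈ J, s ≤ t → ‖p t - p s‖ ≤ M * (t - s) := by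
    intro s hs t ht hst
    refine (hp.1 s hs t ht).norm_sub_le_of_ae_deriv_norm_le hst ?_
    filter_upwards [hp.2] with x hx hmem
    have hxJ : x ∈ J := OrdConnected.out' hs ht (Ioo_subset_Icc_self hmem)
    obtain ⟨v, hv, hd⟩ := hx hxJ
    exact ⟨v, norm_le_of_mem_filippovMap hU hM (hpU x hxJ) hv, hd⟩
  refine LipschitzOnWith.of_dist_le_mul fun s hs t ht => ?_
  rw [Real.coe_toNNReal M hM0]
  rcases le_total s t with hst | hst
  · rw [dist_comm, dist_eq_norm, dist_comm s t, Real.dist_eq, abs_of_nonneg (sub_nonneg.2 hst)]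
    exact aux s hs t ht hst
  · rw [dist_eq_norm, Real.dist_eq, abs_of_nonneg (sub_nonneg.2 hst)]
    exact aux t ht s hs hst

end

/-! ### Choice of the neighbourhood and proof of the theorem -/

theorem theorem3 {n m d : ℕ} (G : SimpleGraph (Fin n)) (o : EdgeOrientation G m)
    (dist : Fin m → ℝ) (pstar : Configuration n d)
    (hdist : ∀ k, ‖o.relPos pstar k‖ = dist k)
    (hrigid : o.IsInfinitesimallyMinimallyRigid pstar)
    (δmax : ℝ) (hδmax : 0 < δmax) :
    ∃ ε : ℝ, 0 < ε ∧ ∀ δ : ℝ, 0 < δ → δ ≤ δmax →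
      ∀ p₀ : Configuration n d, ShapeClose ε pstar p₀ →
        -- there is a Filippov solution on `[0, ∞)` starting at `p₀`
        (∃ p : ℝ → Configuration n d,
          IsFilippovSolution (o.controller (asymQuantizer δ) dist) (Ici 0) p ∧ p 0 = p₀) ∧
        -- no finite escape: solutions on `[0, τ)` extend to solutions on `[0, ∞)`
        (∀ τ : ℝ, 0 < τ → ∀ p : ℝ → Configuration n d,
          IsFilippovSolution (o.controller (asymQuantizer δ) dist) (Ico 0 τ) p → p 0 = p₀ →
            ∃ p' : ℝ → Configuration n d,
              IsFilippovSolution (o.controller (asymQuantizer δ) dist) (Ici 0) p' ∧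
                EqOn p' p (Ico 0 τ)) ∧
        -- along every solution the distance errors reach the set in finite time and stay in it
        (∀ p : ℝ → Configuration n d,
          IsFilippovSolution (o.controller (asymQuantizer δ) dist) (Ici 0) p → p 0 = p₀ →
            ∃ T : ℝ, 0 ≤ T ∧ ∀ t : ℝ, T ≤ t →
              o.distError dist (p t) ∈ asymErrorSet m δ) := by
  obtain ⟨r, hr, c, hc, hrc⟩ := o.exists_velocity_lower_bound hrigid
  have hκ : 0 < c / (2 * (m : ℝ) + 1) / 2 := by positivity
  set κ := c / (2 * (m : ℝ) + 1) / 2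
  -- Errors at the start are at most `2ε`, so the root bounds `√V(p₀)` for every `δ ≤ δmax`; this is
  -- where the bound on `δ` enters.
  obtain ⟨ε, hε, hεr⟩ :
      ∃ ε > 0, ε + √(m * ((2 * ε + δmax) * (2 * ε))) / κ < r := by
    have hlim : Filter.Tendsto (fun ε : ℝ => ε + √(m * ((2 * ε + δmax) * (2 * ε))) / κ)
        (nhdsWithin 0 (Ioi 0)) (nhds 0) := by
      have : Continuous fun ε : ℝ => ε + √(m * ((2 * ε + δmax) * (2 * ε))) / κ := by fun_prop
      simpa using (this.tendsto 0).mono_left nhdsWithin_le_nhds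
    obtain ⟨ε, h1, h2⟩ := ((hlim.eventually (gt_mem_nhds hr)).and self_mem_nhdsWithin).exists
    exact ⟨ε, h2, h1⟩
  refine ⟨ε, hε, fun δ hδ hδle p₀ ⟨g, hg⟩ => ?_⟩
  set P : Configuration n d := fun i => g (pstar i)
  have hp₀P : Dist.dist p₀ P < ε :=
    (dist_pi_lt_iff hε).2 fun i => by rw [dist_eq_norm]; exact hg i
  have hP : ∀ k, o.distError dist P k = 0 := fun k => by
    simp only [EdgeOrientation.distError, P, o.relPos_isometry, LinearIsometryEquiv.norm_map,
      hdist, sub_self]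
  have herr : ∀ (ρ : ℝ) (p : Configuration n d), Dist.dist p P ≤ ρ →
      ∀ k, |o.distError dist p k| ≤ 2 * ρ := fun ρ p hp k => by
    have := o.abs_distError_sub_le dist p P k
    rw [hP, sub_zero] at this
    linarith
  have hW : o.IsRigidRegion dist c (2 * r) (Metric.ball P r) :=
    ⟨fun p hp => (hrc g p hp).1, fun p hp => (hrc g p hp).2,
      fun p hp => herr r p (Metric.mem_ball.1 hp).le⟩
  have hr2 : 0 ≤ 2 * r := by positivity
  have hstart : Dist.dist p₀ P + √(o.potential δ dist p₀) / κ < r := by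
    have hpot : o.potential δ dist p₀ ≤ m * ((2 * ε + δmax) * (2 * ε)) := by
      refine (o.potential_le hδ dist (herr ε p₀ hp₀P.le) (by positivity)).trans ?_
      gcongr
    have : √(o.potential δ dist p₀) / κ ≤ √(m * ((2 * ε + δmax) * (2 * ε))) / κ := by
      gcongr
    linarith
  have hM0 : 0 ≤ m * (2 * r + δ) := by positivity
  have hM : ∀ p ∈ Metric.ball P r, ‖o.controller (asymQuantizer δ) dist p‖ ≤ m * (2 * r + δ) :=
    fun p hp => o.norm_controller_le hδ (hW.abs_distError_le p hp)
  -- A curve known to solve the inclusion only inside the ball never leaves it, hence is a solution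
  -- for all time.
  have hglobal : ∀ (q : ℝ → Configuration n d) (L : NNReal), LipschitzWith L q → q 0 = p₀ →
      (∀ᵐ t : ℝ, 0 < t → q t ∈ Metric.ball P r →
        ∃ v ∈ filippovMap (o.controller (asymQuantizer δ) dist) (q t), HasDerivAt q v t) →
      IsFilippovSolution (o.controller (asymQuantizer δ) dist) (Ici 0) q := by
    intro q L hqL hq0 hq
    refine hqL.isFilippovSolution ?_
    filter_upwards [hq] with t ht ht0
    refine ht ht0 (hW.mem_ball hc hr2 hδ hqL.lipschitzOnWith.absolutelyContinuousOnInterval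
      (T := t) ?_ (by rw [hq0]; exact hstart) t ⟨ht0.le, le_rfl⟩)
    filter_upwards [hq] with x hx hmem
    exact hx hmem.1
  refine ⟨?_, ?_, ?_⟩
  · obtain ⟨q, hqL, hq0, hq⟩ := exists_lipschitz_filippov Metric.isOpen_ball hM0 hM p₀
    exact ⟨q, hglobal q _ hqL hq0 hq, hq0⟩
  · intro τ hτ p hp hp0
    have hpU : ∀ t ∈ Ico 0 τ, p t ∈ Metric.ball P r := by
      intro t ht
      refine hW.mem_ball hc hr2 hδ (hp.1 0 ⟨le_rfl, hτ⟩ t ht) ?_ (by rw [hp0]; exact hstart) t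
        ⟨ht.1, le_rfl⟩
      filter_upwards [hp.2] with x hx hmem _
      exact hx ⟨hmem.1.le, hmem.2.trans ht.2⟩
    obtain ⟨q, L, hqL, hqp, hq⟩ := exists_lipschitz_filippov_extension Metric.isOpen_ball hM0 hM
      (hp.lipschitzOnWith Metric.isOpen_ball hM0 hM hpU) hp.2
    exact ⟨q, hglobal q L hqL (by rw [hqp ⟨le_rfl, hτ⟩, hp0]) hq, hqp⟩
  · intro p hp hp0
    have hpU : ∀ t, 0 ≤ t → p t ∈ Metric.ball P r := by
      intro t ht
      refine hW.mem_ball hc hr2 hδ (hp.1 0 (mem_Ici.2 le_rfl) t ht) ?_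
        (by rw [hp0]; exact hstart) t ⟨ht, le_rfl⟩
      filter_upwards [hp.2] with x hx hmem _
      exact hx hmem.1.le
    obtain ⟨T, hT, h⟩ := hW.exists_potential_eq_zero hc hr2 hδ hp hpU
    exact ⟨T, hT, fun t ht => (o.potential_eq_zero_iff hδ dist _).1 (h t ht)⟩
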